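/- \textbf{Setting.} One observes i.i.d. $Y_j=X_j+\varepsilon_j$, $1\le j\le n$, with $X_j$ independent of $\varepsilon_j$. Fix $d\ge 1$ and $m\ge 0$. For $k=1,\dots,d$ let $\{f_\theta\}_{\theta\in\Theta_k}$, $\Theta_k\subseteq\mathbb R^k$ open, and $\{h_\eta\}_{\eta\in\Lambda}$, $\Lambda\subseteq\mathbb R^m$ open, be families of probability densities on $\mathbb R$. The submodels are nested: for a base sequence $(\theta_{0,1},\dots,\theta_{0,d})$ and $k\le l\le d$, appending $\theta_{0,k+1},\dots,\theta_{0,l}$ to $\theta\in\Theta_k$ gives an element of $\Theta_l$ with (a.e.) the same density $f_\theta$. Write $\theta_0=(\theta_{0,1},\dots,\theta_{0,k})\in\Theta_k$; the null hypothesis is $H_0:\theta=\theta_0$ with $\eta\in\Lambda$ unknown. Let $$g(y;(\theta,\eta))=\int_{\mathbb R} f_\theta(s)h_\eta(y-s)\,ds ,$$ let $G_{\theta,\eta}$ be the law with density $g(\cdot;(\theta,\eta))$, let $\dot l_\theta=\frac{\partial_\theta g}{g}1_{[g>0]}$ and $\dot l_\eta=\frac{\partial_\eta g}{g}1_{[g>0]}$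 be the scores, and let $I(\theta,\eta)=E_{\theta,\eta}(\dot l_\theta,\dot l_\eta)^T(\dot l_\theta,\dot l_\eta)$ be the Fisher information matrix with blocks $I_{11},I_{12},I_{21},I_{22}$. Assume for every $k\le d$: $g(y;\cdot)$ is continuously differentiable on $\Theta_k\times\Lambda$ for Lebesgue-almost all $y$; the scores are in $L_2(G_{\theta,\eta})$; $I(\theta,\eta)$ is nonsingular and continuous on $\Theta_k\times\Lambda$. The efficient score and the efficient information at $(\theta_0,\eta)$ are $$l^*_{\theta_0,\eta}=\dot l_{\theta_0}-I_{12}I_{22}^{-1}\dot l_{\eta},\qquad I^*_{\theta_0,\eta}=E_{\theta_0,\eta}\,l^{*T}_{\theta_0,\eta}l^*_{\theta_0,\eta}.$$ \textbf{Estimators and tests.} For every $k\le d$ and $n$ let $l^*_j\in\mathbb R^k$ ($j\le n$) and $\widehat L\in\mathbb R^{k\times k}$ be measurable functions of $Y_1,\dots,Y_n$, and let $$W_k=\Bigl\{\tfrac1{\sqrt n}\sum_{j=1}^n l^*_j\Bigr\}\,\widehat L\,\Bigl\{\tfrac1{\sqrt n}\sum_{j=1}^n l^*_j\Bigr\}^T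 .$$ For a law $P$ of the observations and $\eta\in\Lambda$ consider $$(14)\quad \tfrac1{\sqrt n}\Bigl\|\sum_{j=1}^n\bigl(l^*_j-l^*_{\theta_0,\eta}(Y_j)\bigr)\Bigr\|\to0\ \text{ in } P^n\text{-probability},\qquad (14')\quad \text{the same with } \tfrac1n \text{ in place of } \tfrac1{\sqrt n},$$ $$(L)\quad \widehat L\to (I^*_{\theta_0,\eta})^{-1}\ \text{ in } P^n\text{-probability}.$$ Let $\pi(j,n)$ be a penalty: $\pi(1,n)<\dots<\pi(d,n)$ for all large $n$, and $\pi(j,n)-\pi(1,n)\to\infty$ for $2\le j\le d$. Let $$S=\min\{k: 1\le k\le d;\ W_k-\pi(k,n)\ge W_j-\pi(j,n),\ j=1,\dots,d\}.$$ Condition $\langle S1\rangle$: $\pi(k,n)=o(n)$ for each fixed $k$ with $1\le k\le d$. For $\alpha\in(0,1)$ the test based on $W_k$ rejects when $W_k$ exceeds the critical point $c$ with $P(\chi^2_k>c)=\alpha$; the test based on $W_S$ uses $\chi^2_1$. The test is \emph{consistent} against a law $P$ if, for every $\alpha\in(0,1)$, its rejection probability tends to $\alpha$ under $G_{\theta_0,\eta}$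 for every $\eta\in\Lambda$ and tends to $1$ under $P$. It is \emph{inconsistent} against $P$ if for every $\alpha\in(0,1)$ its rejection probability under $P$ is eventually bounded by some $\beta<1$. \textbf{Theorem.} Let $F$, $H$ be arbitrary probability distributions on $\mathbb R$ (the true laws of $X$ and $\varepsilon$), let $\eta_0\in\Lambda$, and assume with some integer $K$ $\langle C1\rangle$ $1\le K\le d$, $E_{F*H}\,l^*_{\theta_0,\eta_0(i)}=0$ for $i<K$ and $E_{F*H}\,l^*_{\theta_0,\eta_0(K)}=C_K\neq0$ (these expectations exist; the coordinates do not depend on the submodel used). \begin{enumerate} \item Let $K\le k\le d$. If (14) and (L) hold for $k$ with $P=G_{\theta_0,\eta}$, for every $\eta\in\Lambda$, and (14$'$) and (L) hold for $k$ with $P=F*H$, $\eta=\eta_0$, then the test based on $W_k$ is consistent against $F*H$. \item Let $1\le k<K$ and $E_{F*H}\|l^*_{\theta_0,\eta_0}\|^2<\infty$ for the $k$-dimensional efficient score. If (14) and (L) hold for $k$ with $P=F*H$, $\eta=\eta_0$, then the test based on $W_k$ is inconsistent against $F*H$. \item If $\langle S1\rangle$ holds and the conditions on the estimators in part 1 hold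 for all $k\le d$, then the test based on $W_S$ is consistent against $F*H$. \end{enumerate} -/

import Mathlib

open MeasureTheory ProbabilityTheory Filter Topology Set Matrix

noncomputable section

namespace Deconv

/-- `p` is a probability density on the real line with respect to Lebesgue measure. -/
def IsDensity (p : ℝ → ℝ) : Prop :=
  Measurable p ∧ (∀ x, 0 ≤ p x) ∧ ∫⁻ x, ENNReal.ofReal (p x) = 1

/-- The vector of length `l` that starts with the coordinates of `θ` and continues with the
coordinates of the base point `θ₀`. -/
def pad (θ₀ : ℕ → ℝ) {k : ℕ} (l : ℕ) (θ : Fin k → ℝ) : Fin l → ℝ :=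
  fun i => if hi : (i : ℕ) < k then θ ⟨i, hi⟩ else θ₀ i

/-- A nested family of parametric submodels for the signal density, of dimensions
`k = 1, …, d`, together with one `m`-dimensional parametric family for the noise density.
Only the values of `f` and `Θ` at `1 ≤ k ≤ d`, and the first `d` terms of `θ₀`, matter.
The null value of the `k`-dimensional parameter is `(θ₀ 0, …, θ₀ (k - 1))`. -/
structure Model (d m : ℕ) where
  /-- `f k θ` is the density of the signal in the `k`-dimensional submodel. -/
  f : (k : ℕ) → (Fin k → ℝ) → ℝ → ℝ
  /-- the parameter set of the `k`-dimensional submodel -/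
  Θ : (k : ℕ) → Set (Fin k → ℝ)
  /-- `h η` is the density of the noise. -/
  h : (Fin m → ℝ) → ℝ → ℝ
  /-- the set of nuisance parameters -/
  Λ : Set (Fin m → ℝ)
  /-- the null value of the parameter of interest -/
  θ₀ : ℕ → ℝ
  isOpen_Θ : ∀ k, 1 ≤ k → k ≤ d → IsOpen (Θ k)
  isOpen_Λ : IsOpen Λ
  null_mem : ∀ k, 1 ≤ k → k ≤ d → (fun i : Fin k => θ₀ i) ∈ Θ k
  density_f : ∀ k, 1 ≤ k → k ≤ d → ∀ θ ∈ Θ k, IsDensity (f k θ)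
  density_h : ∀ η ∈ Λ, IsDensity (h η)
  nested : ∀ k l, 1 ≤ k → k ≤ l → l ≤ d → ∀ θ ∈ Θ k,
    pad θ₀ l θ ∈ Θ l ∧ f l (pad θ₀ l θ) =ᵐ[volume] f k θ

namespace Model

variable {d m : ℕ} (M : Model d m)

/-- The null value of the parameter in the `k`-dimensional submodel. -/
def null (k : ℕ) : Fin k → ℝ := fun i => M.θ₀ i

/-- The density `g(y; (θ, η))` of an observation `Y = X + ε`. -/
def g (k : ℕ) (θ : Fin k → ℝ) (η : Fin m → ℝ) (y : ℝ) : ℝ :=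
  ∫ s, M.f k θ s * M.h η (y - s)

/-- The law `G_{θ, η}` of an observation. -/
def G (k : ℕ) (θ : Fin k → ℝ) (η : Fin m → ℝ) : Measure ℝ :=
  volume.withDensity fun y => ENNReal.ofReal (M.g k θ η y)

/-- The score function for `θ`: partial derivatives of `g` in `θ`, divided by `g`, where `g > 0`. -/
def scoreθ (k : ℕ) (θ : Fin k → ℝ) (η : Fin m → ℝ) (y : ℝ) : Fin k → ℝ := fun i =>
  if 0 < M.g k θ η y then
    lineDeriv ℝ (fun θ' => M.g k θ' η y) θ (Pi.single i 1) / M.g k θ η y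
  else 0

/-- The score function for `η`. -/
def scoreη (k : ℕ) (θ : Fin k → ℝ) (η : Fin m → ℝ) (y : ℝ) : Fin m → ℝ := fun j =>
  if 0 < M.g k θ η y then
    lineDeriv ℝ (fun η' => M.g k θ η' y) η (Pi.single j 1) / M.g k θ η y
  else 0

/-- The joint score function for `(θ, η)`. -/
def score (k : ℕ) (θ : Fin k → ℝ) (η : Fin m → ℝ) (y : ℝ) : Fin k ⊕ Fin m → ℝ :=
  Sum.elim (M.scoreθ k θ η y) (M.scoreη k θ η y)

/-- The Fisher information matrix of `(θ, η)`. -/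
def fisher (k : ℕ) (θ : Fin k → ℝ) (η : Fin m → ℝ) :
    Matrix (Fin k ⊕ Fin m) (Fin k ⊕ Fin m) ℝ :=
  Matrix.of fun a b => ∫ y, M.score k θ η y a * M.score k θ η y b ∂(M.G k θ η)

/-- The efficient score function for `θ`: the score for `θ` minus `I₁₂ I₂₂⁻¹` times the score
for `η`. -/
def effScore (k : ℕ) (θ : Fin k → ℝ) (η : Fin m → ℝ) (y : ℝ) : Fin k → ℝ :=
  M.scoreθ k θ η y -
    ((M.fisher k θ η).toBlocks₁₂ * ((M.fisher k θ η).toBlocks₂₂)⁻¹) *ᵥ M.scoreη k θ η y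

/-- The efficient Fisher information matrix for `θ`. -/
def effFisher (k : ℕ) (θ : Fin k → ℝ) (η : Fin m → ℝ) : Matrix (Fin k) (Fin k) ℝ :=
  Matrix.of fun i j => ∫ y, M.effScore k θ η y i * M.effScore k θ η y j ∂(M.G k θ η)

/-- Regularity of all the submodels of dimensions `1, …, d`. -/
def Regular : Prop :=
  ∀ k, 1 ≤ k → k ≤ d →
    (∀ᵐ y : ℝ, ContDiffOn ℝ 1
      (fun p : (Fin k → ℝ) × (Fin m → ℝ) => M.g k p.1 p.2 y) (M.Θ k ×ˢ M.Λ)) ∧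
    (∀ θ ∈ M.Θ k, ∀ η ∈ M.Λ, ∀ a, MemLp (fun y => M.score k θ η y a) 2 (M.G k θ η)) ∧
    (∀ θ ∈ M.Θ k, ∀ η ∈ M.Λ, IsUnit (M.fisher k θ η).det) ∧
    ContinuousOn (fun p : (Fin k → ℝ) × (Fin m → ℝ) => M.fisher k p.1 p.2) (M.Θ k ×ˢ M.Λ)

/-- The efficient score at the null value of the parameter of interest and at `η`. -/
def effScoreNull (k : ℕ) (η : Fin m → ℝ) : ℝ → Fin k → ℝ := M.effScore k (M.null k) η

/-- Condition C1 for the law `μ` of an observation, with the integer `K`: the first `K - 1`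
coordinates of the efficient score have expectation `0`, and the `K`-th one has an expectation
different from `0`. -/
def C1 (μ : Measure ℝ) (η : Fin m → ℝ) (K : ℕ) : Prop :=
  1 ≤ K ∧ K ≤ d ∧
  (∀ i : Fin d, (i : ℕ) + 1 < K →
    Integrable (fun y => M.effScoreNull d η y i) μ ∧ ∫ y, M.effScoreNull d η y i ∂μ = 0) ∧
  (∀ i : Fin d, (i : ℕ) + 1 = K →
    Integrable (fun y => M.effScoreNull d η y i) μ ∧ ∫ y, M.effScoreNull d η y i ∂μ ≠ 0)

/-- The laws of an observation under the composite null hypothesis. -/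
def nullLaws (k : ℕ) : Set (Measure ℝ) := {μ | ∃ η ∈ M.Λ, μ = M.G k (M.null k) η}

end Model

/-- The law of `n` independent observations with law `μ`. -/
def sampleLaw (μ : Measure ℝ) (n : ℕ) : Measure (Fin n → ℝ) := Measure.pi fun _ => μ

/-- Estimators that depend on the observations only: `l k n Y j` estimates the efficient score of
the `k`-dimensional submodel at the `j`-th of `n` observations, and `L k n Y` estimates the
inverse of the efficient Fisher information matrix. -/
structure Estimators where
  l : (k n : ℕ) → (Fin n → ℝ) → Fin n → Fin k → ℝ
  L : (k n : ℕ) → (Fin n → ℝ) → Matrix (Fin k) (Fin k) ℝ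
  measurable_l : ∀ k n j i, Measurable fun y => l k n y j i
  measurable_L : ∀ k n i j, Measurable fun y => L k n y i j

namespace Estimators

variable (E : Estimators) {d m : ℕ}

/-- The sum of the errors of the estimated efficient scores, times `a n`, tends to `0` in
probability when the observations have law `μ` and the target is the efficient score at `η`. -/
def ScoreErrorVanishes (M : Model d m) (k : ℕ) (η : Fin m → ℝ) (μ : Measure ℝ)
    (a : ℕ → ℝ) : Prop :=
  ∀ ε > 0, Tendsto (fun n : ℕ => sampleLaw μ n
    {y | ε ≤ a n * ‖WithLp.toLp 2 (∑ j, (E.l k n y j - M.effScoreNull k η (y j)))‖})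
    atTop (𝓝 0)

/-- The estimated efficient scores are sufficiently good (normalization `1 / √n`). -/
def SufficientlyGood (M : Model d m) (k : ℕ) (η : Fin m → ℝ) (μ : Measure ℝ) : Prop :=
  E.ScoreErrorVanishes M k η μ fun n => 1 / √(n : ℝ)

/-- The average efficient score is consistently estimated (normalization `1 / n`). -/
def AverageConsistent (M : Model d m) (k : ℕ) (η : Fin m → ℝ) (μ : Measure ℝ) : Prop :=
  E.ScoreErrorVanishes M k η μ fun n => 1 / (n : ℝ)

/-- `L` is a consistent estimate of the inverse efficient Fisher information at `η` when the
observations have law `μ`. -/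
def InformationConsistent (M : Model d m) (k : ℕ) (η : Fin m → ℝ) (μ : Measure ℝ) : Prop :=
  ∀ i j, ∀ ε > 0, Tendsto (fun n : ℕ => sampleLaw μ n
    {y | ε ≤ |E.L k n y i j - (M.effFisher k (M.null k) η)⁻¹ i j|}) atTop (𝓝 0)

/-- The estimators of the `k`-dimensional submodel are good at every law of the null
hypothesis. -/
def GoodUnderNull (M : Model d m) (k : ℕ) : Prop :=
  ∀ η ∈ M.Λ, E.SufficientlyGood M k η (M.G k (M.null k) η) ∧
    E.InformationConsistent M k η (M.G k (M.null k) η)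

/-- The normalized sum of the estimated efficient scores. -/
def normalizedSum (k n : ℕ) (y : Fin n → ℝ) : Fin k → ℝ := (1 / √(n : ℝ)) • ∑ j, E.l k n y j

/-- The efficient score test statistic `W_k`. -/
def W (k n : ℕ) (y : Fin n → ℝ) : ℝ :=
  E.normalizedSum k n y ⬝ᵥ (E.L k n y *ᵥ E.normalizedSum k n y)

/-- The selection rule: the smallest dimension that maximizes the penalized statistic. -/
def S (d : ℕ) (π : ℕ → ℕ → ℝ) (n : ℕ) (y : Fin n → ℝ) : ℕ :=
  sInf {k | 1 ≤ k ∧ k ≤ d ∧ ∀ j, 1 ≤ j → j ≤ d → E.W j n y - π j n ≤ E.W k n y - π k n}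

/-- The data-driven efficient score test statistic `W_S`. -/
def WS (d : ℕ) (π : ℕ → ℕ → ℝ) (n : ℕ) (y : Fin n → ℝ) : ℝ := E.W (E.S d π n y) n y

end Estimators

/-- `π j n` is a penalty attributed to the `j`-th model and the sample size `n`. -/
def IsPenalty (d : ℕ) (π : ℕ → ℕ → ℝ) : Prop :=
  (∀ᶠ n in atTop, ∀ i j, 1 ≤ i → i < j → j ≤ d → π i n < π j n) ∧
  ∀ j, 2 ≤ j → j ≤ d → Tendsto (fun n => π j n - π 1 n) atTop atTop

/-- Condition S1: every penalty is `o(n)`. -/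
def S1 (d : ℕ) (π : ℕ → ℕ → ℝ) : Prop :=
  ∀ k, 1 ≤ k → k ≤ d → (fun n => π k n) =o[atTop] fun n => (n : ℝ)

/-- The central chi-square distribution with `k` degrees of freedom. -/
def chiSq (k : ℕ) : Measure ℝ :=
  (Measure.pi fun _ : Fin k => gaussianReal 0 1).map fun z => ∑ i, z i ^ 2

/-- `c` is a critical point of the law `ν` at level `α`. -/
def IsCritical (ν : Measure ℝ) (α c : ℝ) : Prop := ν (Ioi c) = ENNReal.ofReal α

/-- The probability that the test which rejects for `T > c` rejects, from `n` observations with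
law `μ`. -/
def power (T : (n : ℕ) → (Fin n → ℝ) → ℝ) (c : ℝ) (μ : Measure ℝ) (n : ℕ) : ENNReal :=
  sampleLaw μ n {y | c < T n y}

/-- The test based on `T`, with critical points of the law `ν`, is consistent for testing the null
hypothesis `P₀` against `μ`: for every `α` the test with the critical point of level `α` has
asymptotic level `α` at each law in `P₀`, and its power at `μ` tends to `1`. -/
def ConsistentAgainst (T : (n : ℕ) → (Fin n → ℝ) → ℝ) (ν : Measure ℝ) (P₀ : Set (Measure ℝ))
    (μ : Measure ℝ) : Prop :=
  ∀ α ∈ Ioo (0 : ℝ) 1, ∀ c, IsCritical ν α c →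
    (∀ μ₀ ∈ P₀, Tendsto (power T c μ₀) atTop (𝓝 (ENNReal.ofReal α))) ∧
    Tendsto (power T c μ) atTop (𝓝 1)

/-- The test based on `T`, with critical points of the law `ν`, is inconsistent against `μ`:
at every level its power at `μ` stays bounded away from `1`. -/
def InconsistentAgainst (T : (n : ℕ) → (Fin n → ℝ) → ℝ) (ν : Measure ℝ) (μ : Measure ℝ) : Prop :=
  ∀ α ∈ Ioo (0 : ℝ) 1, ∀ c, IsCritical ν α c →
    ∃ β < (1 : ENNReal), ∀ᶠ n in atTop, power T c μ n ≤ β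

end Deconv

end

noncomputable section

namespace Deconv

/-! ### Elementary properties of the model -/

namespace Model

variable {d m : ℕ} (M : Model d m) {k : ℕ} {θ : Fin k → ℝ} {η : Fin m → ℝ}

/-! Where the efficient score is centred, the central limit theorem and Slutsky's lemma show that
`W_k` converges to a quadratic form of a Gaussian vector (`tendstoInDistribution_W`). At a null law
the covariance of this vector is the efficient information, whose inverse `L` estimates, so the
limit is chi-square (`map_quadForm_inv`).

That scores are centred under the model is not assumed and has to be proved without a dominating
function (`RegularPath.integral_deriv_eq_zero`). Along a line in the parameter space let `φ(s)` be
the integral of `∂ₛ q`. Fubini and the fundamental theorem of calculus give mean zero to `φ` on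
every `[0, t]`, so for either sign `σ` there are points `s → 0` with `σ φ(s) ≤ 0`. Fatou's lemma for
`(∂ₛ q + σ q)² / q`, with continuity of the information, carries this inequality to `s = 0`; the two
signs together give `φ(0) = 0`.

Under the alternative with `K ≤ k`, the `K`-th coordinate of the averaged estimated score is close
to `C_K ≠ 0`, and forms near a positive definite one are coercive, so `W_k ≥ δ n` with probability
tending to one (`exists_linear_lower_bound`). For `k < K` all coordinates are centred and `W_k` has
a limit law, perhaps not chi-square, but with positive mass below any `c > 0`
(`multivariateGaussian_quadForm_lt_pos`).

For `W_S`: under the null all `W_j` are tight while the penalty gaps diverge, so `S = 1` with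
probability tending to one. Under the alternative, maximality of `S` gives `W_S ≥ W_K - π(K,n) +
π(S,n)`, which is of order `n` since the penalties are `o(n)`. -/

lemma g_nonneg (hk : 1 ≤ k) (hkd : k ≤ d) (hθ : θ ∈ M.Θ k) (hη : η ∈ M.Λ) (y : ℝ) :
    0 ≤ M.g k θ η y :=
  integral_nonneg fun s => mul_nonneg ((M.density_f k hk hkd θ hθ).2.1 s)
    ((M.density_h η hη).2.1 (y - s))

lemma measurable_g (hk : 1 ≤ k) (hkd : k ≤ d) (hθ : θ ∈ M.Θ k) (hη : η ∈ M.Λ) :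
    Measurable (M.g k θ η) := by
  have hf := (M.density_f k hk hkd θ hθ).1
  have hh := (M.density_h η hη).1
  have : StronglyMeasurable (fun p : ℝ × ℝ => M.f k θ p.2 * M.h η (p.1 - p.2)) := by
    apply Measurable.stronglyMeasurable
    fun_prop
  exact this.integral_prod_right.measurable

/-- Tonelli and translation invariance. The convolution integral may diverge on a null set of `y`,
where the Bochner integral takes its default value 0; hence the almost everywhere comparison. -/
lemma lintegral_ofReal_g (hk : 1 ≤ k) (hkd : k ≤ d) (hθ : θ ∈ M.Θ k) (hη : η ∈ M.Λ) :
    ∫⁻ y, ENNReal.ofReal (M.g k θ η y) = 1 := by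
  obtain ⟨hf, hf0, hf1⟩ := M.density_f k hk hkd θ hθ
  obtain ⟨hh, hh0, hh1⟩ := M.density_h η hη
  have hm : Measurable (fun p : ℝ × ℝ =>
      ENNReal.ofReal (M.f k θ p.2) * ENNReal.ofReal (M.h η (p.1 - p.2))) := by fun_prop
  have hone : ∫⁻ y, ∫⁻ s, ENNReal.ofReal (M.f k θ s) * ENNReal.ofReal (M.h η (y - s)) = 1 := by
    rw [lintegral_lintegral_swap hm.aemeasurable]
    have : ∀ s, ∫⁻ y, ENNReal.ofReal (M.f k θ s) * ENNReal.ofReal (M.h η (y - s))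
        = ENNReal.ofReal (M.f k θ s) := by
      intro s
      rw [lintegral_const_mul _ (by fun_prop),
        lintegral_sub_right_eq_self (fun y => ENNReal.ofReal (M.h η y)) s, hh1, mul_one]
    simp_rw [this, hf1]
  rw [← hone]
  have hfin : ∀ᵐ y, ∫⁻ s, ENNReal.ofReal (M.f k θ s) * ENNReal.ofReal (M.h η (y - s)) < ⊤ :=
    ae_lt_top hm.lintegral_prod_right' (by rw [hone]; simp)
  refine lintegral_congr_ae ?_
  filter_upwards [hfin] with y hy
  rw [g, integral_eq_lintegral_of_nonneg_ae]
  · simp_rw [ENNReal.ofReal_mul (hf0 _)]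
    exact ENNReal.ofReal_toReal hy.ne
  · exact ae_of_all _ fun s => mul_nonneg (hf0 s) (hh0 _)
  · exact Measurable.aestronglyMeasurable (by fun_prop)

lemma isProbabilityMeasure_G (hk : 1 ≤ k) (hkd : k ≤ d) (hθ : θ ∈ M.Θ k) (hη : η ∈ M.Λ) :
    IsProbabilityMeasure (M.G k θ η) :=
  ⟨by rw [G, withDensity_apply _ MeasurableSet.univ, Measure.restrict_univ,
    M.lintegral_ofReal_g hk hkd hθ hη]⟩

lemma integrable_g (hk : 1 ≤ k) (hkd : k ≤ d) (hθ : θ ∈ M.Θ k) (hη : η ∈ M.Λ) :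
    Integrable (M.g k θ η) := by
  refine ⟨(M.measurable_g hk hkd hθ hη).aestronglyMeasurable, ?_⟩
  rw [hasFiniteIntegral_iff_ofReal (ae_of_all _ (M.g_nonneg hk hkd hθ hη)),
    M.lintegral_ofReal_g hk hkd hθ hη]
  simp

lemma integral_g (hk : 1 ≤ k) (hkd : k ≤ d) (hθ : θ ∈ M.Θ k) (hη : η ∈ M.Λ) :
    ∫ y, M.g k θ η y = 1 := by
  rw [integral_eq_lintegral_of_nonneg_ae (ae_of_all _ (M.g_nonneg hk hkd hθ hη))
    (M.measurable_g hk hkd hθ hη).aestronglyMeasurable, M.lintegral_ofReal_g hk hkd hθ hη]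
  simp

lemma integral_G (hk : 1 ≤ k) (hkd : k ≤ d) (hθ : θ ∈ M.Θ k) (hη : η ∈ M.Λ) (u : ℝ → ℝ) :
    ∫ y, u y ∂(M.G k θ η) = ∫ y, M.g k θ η y * u y := by
  rw [G, integral_withDensity_eq_integral_toReal_smul
    (M.measurable_g hk hkd hθ hη).ennreal_ofReal (by simp)]
  simp_rw [ENNReal.toReal_ofReal (M.g_nonneg hk hkd hθ hη _), smul_eq_mul]

lemma integrable_G_iff (hk : 1 ≤ k) (hkd : k ≤ d) (hθ : θ ∈ M.Θ k) (hη : η ∈ M.Λ) (u : ℝ → ℝ) :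
    Integrable u (M.G k θ η) ↔ Integrable fun y => M.g k θ η y * u y := by
  rw [G, integrable_withDensity_iff_integrable_smul'
    (M.measurable_g hk hkd hθ hη).ennreal_ofReal (by simp)]
  simp_rw [ENNReal.toReal_ofReal (M.g_nonneg hk hkd hθ hη _), smul_eq_mul]

/-! ### Nesting of the submodels -/

lemma null_mem' (hk : 1 ≤ k) (hkd : k ≤ d) : M.null k ∈ M.Θ k := M.null_mem k hk hkd

lemma g_pad {l : ℕ} (hk : 1 ≤ k) (hkl : k ≤ l) (hl : l ≤ d) (hθ : θ ∈ M.Θ k) :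
    M.g l (pad M.θ₀ l θ) η = M.g k θ η := by
  ext y
  refine integral_congr_ae ?_
  filter_upwards [(M.nested k l hk hkl hl θ hθ).2] with s hs
  rw [hs]

lemma pad_null {l : ℕ} : pad M.θ₀ l (M.null k) = M.null l := by
  ext i
  simp [pad, null]

lemma pad_null_add_smul_single {l : ℕ} (hkl : k ≤ l) (i : Fin k) (t : ℝ) :
    pad M.θ₀ l (M.null k + t • Pi.single i 1) =
      M.null l + t • Pi.single (Fin.castLE hkl i) 1 := by
  ext j
  by_cases hj : (j : ℕ) < k
  · simp [pad, hj, null, Pi.single_apply, Fin.ext_iff]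
  · have : j ≠ Fin.castLE hkl i := by
      rintro rfl
      simp at hj
    simp [pad, hj, null, this]

lemma g_null_eq {l : ℕ} (hk : 1 ≤ k) (hkl : k ≤ l) (hl : l ≤ d) :
    M.g k (M.null k) = M.g l (M.null l) := by
  ext η : 1
  rw [← M.g_pad hk hkl hl (M.null_mem' hk (hkl.trans hl)), pad_null]

lemma G_null_eq {l : ℕ} (hk : 1 ≤ k) (hkl : k ≤ l) (hl : l ≤ d) :
    M.G k (M.null k) = M.G l (M.null l) := by
  ext η : 1
  rw [G, G, M.g_null_eq hk hkl hl]

lemma scoreη_null_eq {l : ℕ} (hk : 1 ≤ k) (hkl : k ≤ l) (hl : l ≤ d) :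
    M.scoreη k (M.null k) = M.scoreη l (M.null l) := by
  ext η y j
  simp only [scoreη, M.g_null_eq hk hkl hl]

lemma scoreθ_null_eq {l : ℕ} (hk : 1 ≤ k) (hkl : k ≤ l) (hl : l ≤ d) (η : Fin m → ℝ) (y : ℝ)
    (i : Fin k) :
    M.scoreθ k (M.null k) η y i = M.scoreθ l (M.null l) η y (Fin.castLE hkl i) := by
  have hD : lineDeriv ℝ (fun θ' => M.g k θ' η y) (M.null k) (Pi.single i 1) =
      lineDeriv ℝ (fun θ' => M.g l θ' η y) (M.null l) (Pi.single (Fin.castLE hkl i) 1) := by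
    have hc : Continuous fun t : ℝ => M.null k + t • (Pi.single i 1 : Fin k → ℝ) := by fun_prop
    -- The submodels agree only over `Θ k`; openness makes this enough for the derivative at `t =
    -- 0`.
    have hev : ∀ᶠ t in 𝓝 (0 : ℝ), M.null k + t • (Pi.single i 1 : Fin k → ℝ) ∈ M.Θ k := by
      refine hc.continuousAt.eventually_mem ((M.isOpen_Θ k hk (hkl.trans hl)).mem_nhds ?_)
      simpa using M.null_mem' hk (hkl.trans hl)
    refine EventuallyEq.deriv_eq ?_
    filter_upwards [hev] with t ht
    rw [← M.pad_null_add_smul_single hkl, M.g_pad hk hkl hl ht]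
  simp only [scoreθ, M.g_null_eq hk hkl hl, hD]

/-- Row `i` of `I₁₂` and the block `I₂₂` involve only the `i`-th score and the nuisance scores,
which the nested submodels share. This lets `C1`, stated in dimension `d`, be used in every
dimension `k`. -/
lemma effScoreNull_eq {l : ℕ} (hk : 1 ≤ k) (hkl : k ≤ l) (hl : l ≤ d) (η : Fin m → ℝ) (y : ℝ)
    (i : Fin k) :
    M.effScoreNull k η y i = M.effScoreNull l η y (Fin.castLE hkl i) := by
  have h22 : (M.fisher k (M.null k) η).toBlocks₂₂ = (M.fisher l (M.null l) η).toBlocks₂₂ := by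
    ext a b
    simp [fisher, toBlocks₂₂, score, M.scoreη_null_eq hk hkl hl, M.G_null_eq hk hkl hl]
  have h12 : ∀ b, (M.fisher k (M.null k) η).toBlocks₁₂ i b =
      (M.fisher l (M.null l) η).toBlocks₁₂ (Fin.castLE hkl i) b := by
    intro b
    simp [fisher, toBlocks₁₂, score, M.scoreη_null_eq hk hkl hl, M.G_null_eq hk hkl hl,
      M.scoreθ_null_eq hk hkl hl]
  simp only [effScoreNull, effScore, Pi.sub_apply, M.scoreθ_null_eq hk hkl hl, h22,
    M.scoreη_null_eq hk hkl hl, mulVec, dotProduct, mul_apply, h12]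

end Model

/-! ### Scores have mean zero -/

/-- A one-parameter family of densities that is continuously differentiable in the parameter on
`(-r, r)` and whose Fisher information is finite and continuous. -/
structure RegularPath {α : Type*} [MeasurableSpace α] (μ : Measure α) (r : ℝ) (q : ℝ → α → ℝ) :
    Prop where
  pos : 0 < r
  measurable : ∀ s ∈ Ioo (-r) r, Measurable (q s)
  nonneg : ∀ s ∈ Ioo (-r) r, ∀ y, 0 ≤ q s y
  integrable : ∀ s ∈ Ioo (-r) r, Integrable (q s) μ
  integral_eq_one : ∀ s ∈ Ioo (-r) r, ∫ y, q s y ∂μ = 1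
  contDiffOn : ∀ᵐ y ∂μ, ContDiffOn ℝ 1 (fun s => q s y) (Ioo (-r) r)
  integrable_info : ∀ s ∈ Ioo (-r) r,
    Integrable (fun y => deriv (fun s' => q s' y) s ^ 2 / q s y) μ
  continuousOn_info :
    ContinuousOn (fun s => ∫ y, deriv (fun s' => q s' y) s ^ 2 / q s y ∂μ) (Ioo (-r) r)

namespace RegularPath

variable {α : Type*} [MeasurableSpace α] {μ : Measure α} {r : ℝ} {q : ℝ → α → ℝ}

/-- A zero of a nonnegative function is a minimum. Hence the convention `0 / 0 = 0` loses nothing in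
the information integrand. -/
lemma deriv_eq_zero (h : RegularPath μ r q) {s : ℝ} (hs : s ∈ Ioo (-r) r) {y : α}
    (hy : q s y = 0) : deriv (fun s' => q s' y) s = 0 := by
  refine IsLocalMin.deriv_eq_zero ?_
  filter_upwards [isOpen_Ioo.mem_nhds hs] with t ht
  simpa [hy] using h.nonneg t ht y

lemma aemeasurable_deriv (h : RegularPath μ r q) {s : ℝ} (hs : s ∈ Ioo (-r) r) :
    AEMeasurable (fun y => deriv (fun s' => q s' y) s) μ := by
  have hpos : 0 < r - s := sub_pos.2 hs.2
  obtain ⟨u, hu0, hu⟩ : ∃ u : ℕ → ℝ, (∀ n, u n ∈ Ioo s r) ∧ Tendsto u atTop (𝓝 s) := by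
    obtain ⟨u, -, h1, h2⟩ := exists_seq_strictAnti_tendsto' hs.2
    exact ⟨u, h1, h2⟩
  have hur : ∀ n, u n ∈ Ioo (-r) r := fun n => ⟨hs.1.trans (hu0 n).1, (hu0 n).2⟩
  refine aemeasurable_of_tendsto_metrizable_ae (u := atTop)
    (f := fun (n : ℕ) y => (u n - s)⁻¹ * (q (u n) y - q s y)) (fun n => ?_) ?_
  · exact (((h.measurable _ (hur n)).sub (h.measurable s hs)).const_mul _).aemeasurable
  · filter_upwards [h.contDiffOn] with y hy
    have hd : HasDerivAt (fun s' => q s' y) (deriv (fun s' => q s' y) s) s :=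
      ((hy.differentiableOn one_ne_zero).differentiableAt (isOpen_Ioo.mem_nhds hs)).hasDerivAt
    have := hasDerivAt_iff_tendsto_slope.1 hd
    refine (this.comp (f := u) ?_).congr fun n => ?_
    · exact tendsto_nhdsWithin_iff.2 ⟨hu, Eventually.of_forall fun n => (hu0 n).1.ne'⟩
    · simp [slope_def_module]

/-- From `(|q'| - q)² ≥ 0`. It turns bounds on the information into `L¹` bounds on the derivative.
-/
lemma abs_deriv_le (h : RegularPath μ r q) {s : ℝ} (hs : s ∈ Ioo (-r) r) (y : α) :
    |deriv (fun s' => q s' y) s| ≤ deriv (fun s' => q s' y) s ^ 2 / q s y + q s y := by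
  rcases (h.nonneg s hs y).eq_or_lt with h0 | h0
  · simp [h.deriv_eq_zero hs h0.symm, ← h0]
  · rw [div_add' _ _ _ h0.ne', le_div_iff₀ h0, ← sq_abs (deriv _ _)]
    nlinarith [sq_nonneg (|deriv (fun s' => q s' y) s| - q s y),
      sq_nonneg (|deriv (fun s' => q s' y) s|)]

lemma integrable_deriv (h : RegularPath μ r q) {s : ℝ} (hs : s ∈ Ioo (-r) r) :
    Integrable (fun y => deriv (fun s' => q s' y) s) μ :=
  ((h.integrable_info s hs).add (h.integrable s hs)).mono'
    (h.aemeasurable_deriv hs).aestronglyMeasurable (ae_of_all _ (h.abs_deriv_le hs))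

/-- A version of the derivative that is jointly measurable. -/
lemma exists_measurable_deriv (h : RegularPath μ r q) {t : ℝ} (ht : t ∈ Ioo 0 r) :
    ∃ D : ℝ → α → ℝ, Measurable (Function.uncurry D) ∧
      ∀ᵐ y ∂μ, ∀ s ∈ Icc 0 t, D s y = deriv (fun s' => q s' y) s := by
  have hmem : ∀ s, (projIcc 0 t ht.1.le s : ℝ) ∈ Ioo (-r) r := fun s =>
    ⟨by linarith [(projIcc 0 t ht.1.le s).2.1, h.pos], (projIcc 0 t ht.1.le s).2.2.trans_lt ht.2⟩
  obtain ⟨N, hNsub, hNm, hN0⟩ : ∃ N : Set α, {y | ¬ (ContDiffOn ℝ 1 (fun s => q s y) (Ioo (-r) r))}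
      ⊆ N ∧ MeasurableSet N ∧ μ N = 0 :=
    ⟨_, subset_toMeasurable μ _, measurableSet_toMeasurable _ _,
      by rw [measure_toMeasurable]; exact h.contDiffOn⟩
  have hsm : ∀ y ∉ N, ContDiffOn ℝ 1 (fun s => q s y) (Ioo (-r) r) := fun y hy => by
    by_contra hc
    exact hy (hNsub hc)
  -- A function continuous in `s` and measurable in `y` is jointly measurable. Projecting `s` to
  -- `[0, t]` gives continuity on the whole line, and the non-smooth `y` are cut out through a
  -- measurable null set.
  refine ⟨fun s => Nᶜ.indicator fun y => deriv (fun s' => q s' y) (projIcc 0 t ht.1.le s),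
    measurable_uncurry_of_continuous_of_measurable ?_ ?_, ?_⟩
  · intro y
    by_cases hy : y ∈ N
    · simpa [hy] using continuous_const
    · have hc := (hsm y hy).continuousOn_deriv_of_isOpen isOpen_Ioo le_rfl
      have : Continuous fun s => deriv (fun s' => q s' y) (projIcc 0 t ht.1.le s) :=
        hc.comp_continuous (by fun_prop) hmem
      simpa [hy] using this
  · intro s
    set p : ℝ := (projIcc 0 t ht.1.le s : Icc 0 t).1 with hp
    have hpr : p ∈ Ioo (-r) r := hmem s
    obtain ⟨u, -, hu0, hu⟩ := exists_seq_strictAnti_tendsto' hpr.2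
    have hur : ∀ n, u n ∈ Ioo (-r) r := fun n => ⟨hpr.1.trans (hu0 n).1, (hu0 n).2⟩
    refine measurable_of_tendsto_metrizable
      (f := fun (n : ℕ) => Nᶜ.indicator fun y => (u n - p)⁻¹ * (q (u n) y - q p y))
      (fun n => ?_) (tendsto_pi_nhds.2 fun y => ?_)
    · exact (((h.measurable _ (hur n)).sub (h.measurable p hpr)).const_mul _).indicator hNm.compl
    · by_cases hy : y ∈ N
      · simp [hy]
      · have hd : HasDerivAt (fun s' => q s' y) (deriv (fun s' => q s' y) p) p :=
          (((hsm y hy).differentiableOn one_ne_zero).differentiableAt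
            (isOpen_Ioo.mem_nhds hpr)).hasDerivAt
        have := hasDerivAt_iff_tendsto_slope.1 hd
        have h2 := this.comp (f := u)
          (tendsto_nhdsWithin_iff.2 ⟨hu, Eventually.of_forall fun n => (hu0 n).1.ne'⟩)
        simpa [hy, slope_def_module, Function.comp_def] using h2
  · have : ∀ᵐ y ∂μ, y ∉ N := measure_eq_zero_iff_ae_notMem.1 hN0
    filter_upwards [this] with y hy s hs
    simp [hy, projIcc_of_mem ht.1.le hs]

/-- After Fubini the inner integral is `q t y - q 0 y`, and both densities have mass one. Fubini
applies because the information is bounded on the compact `[0, t]`. -/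
lemma integral_deriv_intervalIntegrable [SFinite μ] (h : RegularPath μ r q) {t : ℝ}
    (ht : t ∈ Ioo 0 r) :
    IntervalIntegrable (fun s => ∫ y, deriv (fun s' => q s' y) s ∂μ) volume 0 t ∧
      ∫ s in (0 : ℝ)..t, ∫ y, deriv (fun s' => q s' y) s ∂μ = 0 := by
  obtain ⟨D, hDm, hD⟩ := h.exists_measurable_deriv ht
  have hsub : ∀ s ∈ Icc 0 t, s ∈ Ioo (-r) r := fun s hs =>
    ⟨by linarith [hs.1, h.pos], hs.2.trans_lt ht.2⟩
  have hDs : ∀ s ∈ Icc 0 t, D s =ᵐ[μ] fun y => deriv (fun s' => q s' y) s := fun s hs => by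
    filter_upwards [hD] with y hy using hy s hs
  have hφ : ∀ s ∈ Icc 0 t, ∫ y, D s y ∂μ = ∫ y, deriv (fun s' => q s' y) s ∂μ := fun s hs =>
    integral_congr_ae (hDs s hs)
  obtain ⟨C, hC⟩ : ∃ C, ∀ s ∈ Icc 0 t, ∫ y, deriv (fun s' => q s' y) s ^ 2 / q s y ∂μ ≤ C := by
    obtain ⟨C, hC⟩ := (isCompact_Icc.image_of_continuousOn
      (h.continuousOn_info.mono hsub)).bddAbove
    exact ⟨C, fun s hs => hC (mem_image_of_mem _ hs)⟩
  have hint : Integrable (Function.uncurry D) ((volume.restrict (Ioc 0 t)).prod μ) := by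
    rw [integrable_prod_iff hDm.aestronglyMeasurable]
    constructor
    · filter_upwards [ae_restrict_mem measurableSet_Ioc] with s hs
      have hs' := Ioc_subset_Icc_self hs
      exact (h.integrable_deriv (hsub s hs')).congr (hDs s hs').symm
    · refine Integrable.mono' (g := fun _ => C + 1) (integrable_const _)
        (hDm.norm.stronglyMeasurable.integral_prod_right).aestronglyMeasurable ?_
      filter_upwards [ae_restrict_mem measurableSet_Ioc] with s hs
      have hs' := Ioc_subset_Icc_self hs
      rw [Real.norm_of_nonneg (integral_nonneg fun _ => norm_nonneg _)]
      calc ∫ y, ‖Function.uncurry D (s, y)‖ ∂μ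
          ≤ ∫ y, (deriv (fun s' => q s' y) s ^ 2 / q s y + q s y) ∂μ := by
            refine integral_mono_of_nonneg (ae_of_all _ fun _ => norm_nonneg _)
              ((h.integrable_info s (hsub s hs')).add (h.integrable s (hsub s hs'))) ?_
            filter_upwards [hDs s hs'] with y hy
            simpa [hy] using h.abs_deriv_le (hsub s hs') y
        _ ≤ C + 1 := by
            rw [integral_add (h.integrable_info s (hsub s hs')) (h.integrable s (hsub s hs')),
              h.integral_eq_one s (hsub s hs')]
            linarith [hC s hs']
  have hii : IntervalIntegrable (fun s => ∫ y, D s y ∂μ) volume 0 t :=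
    (intervalIntegrable_iff_integrableOn_Ioc_of_le ht.1.le).2 hint.integral_prod_left
  have huI : ∀ s ∈ uIcc 0 t, s ∈ Icc 0 t := fun s hs => by rwa [uIcc_of_le ht.1.le] at hs
  have huo : ∀ s ∈ Set.uIoc 0 t, s ∈ Icc 0 t := fun s hs => huI s (uIoc_subset_uIcc hs)
  refine ⟨hii.congr fun s hs => hφ s (huo s hs), ?_⟩
  rw [← intervalIntegral.integral_congr fun s hs => hφ s (huI s hs),
    intervalIntegral.integral_of_le ht.1.le, integral_integral_swap hint]
  have h0 : (0 : ℝ) ∈ Ioo (-r) r := hsub 0 ⟨le_rfl, ht.1.le⟩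
  have htr : t ∈ Ioo (-r) r := hsub t ⟨ht.1.le, le_rfl⟩
  have hFTC : ∀ᵐ y ∂μ, ∫ s in Ioc 0 t, D s y = q t y - q 0 y := by
    filter_upwards [hD, h.contDiffOn] with y hy hc
    rw [← intervalIntegral.integral_of_le ht.1.le,
      intervalIntegral.integral_congr fun s hs => hy s (huI s hs)]
    have hder : ∀ s ∈ uIcc 0 t,
        HasDerivAt (fun s' => q s' y) (deriv (fun s' => q s' y) s) s := fun s hs =>
      ((hc.differentiableOn one_ne_zero).differentiableAt
        (isOpen_Ioo.mem_nhds (hsub s (huI s hs)))).hasDerivAt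
    refine intervalIntegral.integral_eq_sub_of_hasDerivAt hder ?_
    exact ((hc.continuousOn_deriv_of_isOpen isOpen_Ioo le_rfl).mono
      fun s hs => hsub s (huI s hs)).intervalIntegrable
  rw [integral_congr_ae hFTC, integral_sub (h.integrable t htr) (h.integrable 0 h0),
    h.integral_eq_one t htr, h.integral_eq_one 0 h0, sub_self]

lemma exists_mul_integral_deriv_nonpos [SFinite μ] (h : RegularPath μ r q) (σ : ℝ) {t : ℝ}
    (ht : t ∈ Ioo 0 r) :
    ∃ s ∈ Ioo 0 t, σ * ∫ y, deriv (fun s' => q s' y) s ∂μ ≤ 0 := by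
  by_contra! hcon
  obtain ⟨h1, h2⟩ := h.integral_deriv_intervalIntegrable ht
  have := intervalIntegral.intervalIntegral_pos_of_pos_on (h1.const_mul σ) hcon ht.1
  rw [intervalIntegral.integral_const_mul, h2] at this
  simp at this

/-- Fatou's lemma replaces domination: adding the information and the mass to the signed derivative
completes a square, hence a nonnegative integrand, and the added terms have convergent integrals. -/
lemma mul_integral_deriv_nonpos [SFinite μ] (h : RegularPath μ r q) {σ : ℝ} (hσ : σ ^ 2 = 1) :
    σ * ∫ y, deriv (fun s' => q s' y) 0 ∂μ ≤ 0 := by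
  have h0 : (0 : ℝ) ∈ Ioo (-r) r := ⟨by linarith [h.pos], h.pos⟩
  obtain ⟨t, -, ht0, ht⟩ := exists_seq_strictAnti_tendsto' h.pos
  choose s hs hsσ using fun n => h.exists_mul_integral_deriv_nonpos σ (ht0 n)
  have hslim : Tendsto s atTop (𝓝 0) :=
    tendsto_of_tendsto_of_tendsto_of_le_of_le tendsto_const_nhds ht
      (fun n => (hs n).1.le) (fun n => (hs n).2.le)
  have hsr : ∀ n, s n ∈ Ioo (-r) r := fun n =>
    ⟨by linarith [(hs n).1, h.pos], (hs n).2.trans (ht0 n).2⟩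
  set info : ℝ → ℝ := fun s => ∫ y, deriv (fun s' => q s' y) s ^ 2 / q s y ∂μ with hinfo
  set φ : ℝ → ℝ := fun s => ∫ y, deriv (fun s' => q s' y) s ∂μ with hφ
  set J : ℝ → α → ℝ := fun s y => deriv (fun s' => q s' y) s ^ 2 / q s y +
    2 * (σ * deriv (fun s' => q s' y) s) + q s y with hJ
  have hJint : ∀ s ∈ Ioo (-r) r, Integrable (J s) μ := fun s hs =>
    ((h.integrable_info s hs).add (((h.integrable_deriv hs).const_mul σ).const_mul 2)).add
      (h.integrable s hs)
  have hJ0 : ∀ s ∈ Ioo (-r) r, ∀ y, 0 ≤ J s y := by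
    intro s hs y
    rcases (h.nonneg s hs y).eq_or_lt with h0 | h0
    · simp [hJ, h.deriv_eq_zero hs h0.symm, ← h0]
    · have : J s y = (deriv (fun s' => q s' y) s + σ * q s y) ^ 2 / q s y := by
        simp only [hJ]
        field_simp
        linear_combination (-(q s y) ^ 2) * hσ
      rw [this]
      positivity
  have hJi : ∀ s ∈ Ioo (-r) r, ∫ y, J s y ∂μ = info s + 2 * (σ * φ s) + 1 := by
    intro s hs
    have h2 := ((h.integrable_deriv hs).const_mul σ).const_mul 2
    have h12 : Integrable (fun y => deriv (fun s' => q s' y) s ^ 2 / q s y +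
        2 * (σ * deriv (fun s' => q s' y) s)) μ := (h.integrable_info s hs).add h2
    rw [integral_add h12 (h.integrable s hs), integral_add (h.integrable_info s hs) h2,
      integral_const_mul, integral_const_mul, h.integral_eq_one s hs]
  have hinfo0 : ∀ s, s ∈ Ioo (-r) r → 0 ≤ info s := fun s hs =>
    integral_nonneg fun y => div_nonneg (sq_nonneg _) (h.nonneg s hs y)
  have hfatou : ENNReal.ofReal (info 0 + 2 * (σ * φ 0) + 1) ≤ ENNReal.ofReal (info 0 + 1) := by
    calc ENNReal.ofReal (info 0 + 2 * (σ * φ 0) + 1)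
        = ∫⁻ y, ENNReal.ofReal (J 0 y) ∂μ := by
          rw [← hJi 0 h0, ofReal_integral_eq_lintegral_ofReal (hJint 0 h0)
            (ae_of_all _ (hJ0 0 h0))]
      _ ≤ ∫⁻ y, liminf (fun n => ENNReal.ofReal (J (s n) y)) atTop ∂μ := by
          refine lintegral_mono_ae ?_
          filter_upwards [h.contDiffOn] with y hy
          -- Where the density vanishes at `s = 0`, the quotient may fail to converge, but there `J
          -- 0 y = 0` and the lower bound is trivial.
          rcases (h.nonneg 0 h0 y).eq_or_lt with hq | hq
          · have : J 0 y = 0 := by simp [hJ, h.deriv_eq_zero h0 hq.symm, ← hq]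
            simp [this]
          · have hqc : Tendsto (fun n => q (s n) y) atTop (𝓝 (q 0 y)) :=
              (hy.continuousOn.continuousAt (isOpen_Ioo.mem_nhds h0)).tendsto.comp hslim
            have hdc : Tendsto (fun n => deriv (fun s' => q s' y) (s n)) atTop
                (𝓝 (deriv (fun s' => q s' y) 0)) :=
              ((hy.continuousOn_deriv_of_isOpen isOpen_Ioo le_rfl).continuousAt
                (isOpen_Ioo.mem_nhds h0)).tendsto.comp hslim
            have : Tendsto (fun n => J (s n) y) atTop (𝓝 (J 0 y)) :=
              (((hdc.pow 2).div hqc hq.ne').add ((hdc.const_mul σ).const_mul 2)).add hqc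
            exact (ENNReal.tendsto_ofReal this).liminf_eq.ge
      _ ≤ liminf (fun n => ∫⁻ y, ENNReal.ofReal (J (s n) y) ∂μ) atTop :=
          lintegral_liminf_le' fun n => (hJint _ (hsr n)).aemeasurable.ennreal_ofReal
      _ ≤ liminf (fun n => ENNReal.ofReal (info (s n) + 1)) atTop := by
          refine liminf_le_liminf (Eventually.of_forall fun n => ?_)
          rw [← ofReal_integral_eq_lintegral_ofReal (hJint _ (hsr n))
            (ae_of_all _ (hJ0 _ (hsr n))), hJi _ (hsr n)]
          refine ENNReal.ofReal_le_ofReal ?_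
          linarith [hsσ n]
      _ = ENNReal.ofReal (info 0 + 1) := by
          refine (ENNReal.tendsto_ofReal ?_).liminf_eq
          exact ((h.continuousOn_info.continuousAt (isOpen_Ioo.mem_nhds h0)).tendsto.comp
            hslim).add_const 1
  rw [ENNReal.ofReal_le_ofReal_iff (by linarith [hinfo0 0 h0])] at hfatou
  change σ * φ 0 ≤ 0
  linarith

/-- The derivative of the density with respect to the parameter integrates to zero. -/
theorem integral_deriv_eq_zero [SFinite μ] (h : RegularPath μ r q) :
    ∫ y, deriv (fun s => q s y) 0 ∂μ = 0 := by
  have h1 := h.mul_integral_deriv_nonpos (σ := 1) (by norm_num)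
  have h2 := h.mul_integral_deriv_nonpos (σ := -1) (by norm_num)
  linarith

end RegularPath

namespace Model

variable {d m : ℕ} (M : Model d m) {k : ℕ} {θ : Fin k → ℝ} {η : Fin m → ℝ}

/-- A line through an interior point of the parameter set, in a direction in which the derivative
of the log-density is a coordinate of the score, is a regular path. -/
lemma exists_regularPath (hM : M.Regular) (hk : 1 ≤ k) (hkd : k ≤ d) (hθ : θ ∈ M.Θ k)
    (hη : η ∈ M.Λ) (u : Fin k → ℝ) (v : Fin m → ℝ) (a : Fin k ⊕ Fin m)
    (hscore : ∀ (s : ℝ) y, M.score k (θ + s • u) (η + s • v) y a =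
      if 0 < M.g k (θ + s • u) (η + s • v) y then
        deriv (fun s' => M.g k (θ + s' • u) (η + s' • v) y) s / M.g k (θ + s • u) (η + s • v) y
      else 0) :
    ∃ r, RegularPath volume r fun s y => M.g k (θ + s • u) (η + s • v) y := by
  obtain ⟨hC, hL2, -, hI⟩ := hM k hk hkd
  have hc : Continuous fun s : ℝ => (θ + s • u, η + s • v) := by fun_prop
  have hopen : IsOpen (M.Θ k ×ˢ M.Λ) := (M.isOpen_Θ k hk hkd).prod M.isOpen_Λ
  have hnhds : (fun s : ℝ => (θ + s • u, η + s • v)) ⁻¹' (M.Θ k ×ˢ M.Λ) ∈ 𝓝 (0 : ℝ) :=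
    hc.continuousAt.preimage_mem_nhds (hopen.mem_nhds (by simp [hθ, hη]))
  obtain ⟨r, hr, hsub⟩ := Metric.mem_nhds_iff.1 hnhds
  rw [Real.ball_eq_Ioo, zero_sub, zero_add] at hsub
  have hθs : ∀ s ∈ Ioo (-r) r, θ + s • u ∈ M.Θ k := fun s hs => (hsub hs).1
  have hηs : ∀ s ∈ Ioo (-r) r, η + s • v ∈ M.Λ := fun s hs => (hsub hs).2
  -- The information of the path is thereby the diagonal entry `a` of the Fisher matrix, from which
  -- finiteness and continuity follow.
  have hsq : ∀ s ∈ Ioo (-r) r, ∀ y, M.g k (θ + s • u) (η + s • v) y *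
      (M.score k (θ + s • u) (η + s • v) y a * M.score k (θ + s • u) (η + s • v) y a) =
      deriv (fun s' => M.g k (θ + s' • u) (η + s' • v) y) s ^ 2 /
        M.g k (θ + s • u) (η + s • v) y := by
    intro s hs y
    rw [hscore]
    rcases (M.g_nonneg hk hkd (hθs s hs) (hηs s hs) y).eq_or_lt with h0 | h0
    · simp [← h0]
    · rw [if_pos h0]
      field_simp
  refine ⟨r, hr, fun s hs => M.measurable_g hk hkd (hθs s hs) (hηs s hs),
    fun s hs => M.g_nonneg hk hkd (hθs s hs) (hηs s hs),
    fun s hs => M.integrable_g hk hkd (hθs s hs) (hηs s hs),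
    fun s hs => M.integral_g hk hkd (hθs s hs) (hηs s hs), ?_, fun s hs => ?_, ?_⟩
  · filter_upwards [hC] with y hy
    exact hy.comp (f := fun s : ℝ => (θ + s • u, η + s • v)) (ContDiff.contDiffOn (by fun_prop))
      hsub
  · have h1 := (hL2 _ (hθs s hs) _ (hηs s hs) a).integrable_mul (hL2 _ (hθs s hs) _ (hηs s hs) a)
    rw [M.integrable_G_iff hk hkd (hθs s hs) (hηs s hs)] at h1
    exact h1.congr (ae_of_all _ (hsq s hs))
  · have h1 : ContinuousOn (fun s : ℝ => M.fisher k (θ + s • u) (η + s • v) a a) (Ioo (-r) r) :=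
      ((continuous_apply_apply a a).comp_continuousOn hI).comp
        (f := fun s : ℝ => (θ + s • u, η + s • v)) hc.continuousOn hsub
    refine h1.congr fun s hs => ?_
    simp only [fisher, of_apply, M.integral_G hk hkd (hθs s hs) (hηs s hs)]
    exact integral_congr_ae (ae_of_all _ fun y => (hsq s hs y).symm)

lemma integral_score_of_line (hM : M.Regular) (hk : 1 ≤ k) (hkd : k ≤ d) (hθ : θ ∈ M.Θ k)
    (hη : η ∈ M.Λ) (u : Fin k → ℝ) (v : Fin m → ℝ) (a : Fin k ⊕ Fin m)
    (hscore : ∀ (s : ℝ) y, M.score k (θ + s • u) (η + s • v) y a =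
      if 0 < M.g k (θ + s • u) (η + s • v) y then
        deriv (fun s' => M.g k (θ + s' • u) (η + s' • v) y) s / M.g k (θ + s • u) (η + s • v) y
      else 0) :
    ∫ y, M.score k θ η y a ∂(M.G k θ η) = 0 := by
  obtain ⟨r, hr⟩ := M.exists_regularPath hM hk hkd hθ hη u v a hscore
  rw [M.integral_G hk hkd hθ hη, ← hr.integral_deriv_eq_zero]
  have h0 : (0 : ℝ) ∈ Ioo (-r) r := ⟨by linarith [hr.pos], hr.pos⟩
  refine integral_congr_ae (ae_of_all _ fun y => ?_)
  have h1 := hscore 0 y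
  have h2 := fun h => hr.deriv_eq_zero h0 (y := y) h
  simp only [zero_smul, add_zero] at h1 h2
  simp only [h1]
  rcases (M.g_nonneg hk hkd hθ hη y).eq_or_lt with hq | hq
  · simp [h2 hq.symm, ← hq]
  · rw [if_pos hq]
    field_simp

/-- The score has expectation zero. -/
theorem integral_score (hM : M.Regular) (hk : 1 ≤ k) (hkd : k ≤ d) (hθ : θ ∈ M.Θ k)
    (hη : η ∈ M.Λ) (a : Fin k ⊕ Fin m) : ∫ y, M.score k θ η y a ∂(M.G k θ η) = 0 := by
  rcases a with i | j
  · refine M.integral_score_of_line hM hk hkd hθ hη (Pi.single i 1) 0 _ fun s y => ?_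
    -- `lineDeriv` differentiates at 0 along a line based at the shifted point; a translation moves
    -- this to `s`.
    have : lineDeriv ℝ (fun θ' => M.g k θ' η y) (θ + s • Pi.single i 1) (Pi.single i 1) =
        deriv (fun s' : ℝ => M.g k (θ + s' • Pi.single i 1) η y) s := by
      have h := deriv_comp_const_add (f := fun s' : ℝ => M.g k (θ + s' • Pi.single i 1) η y) s 0
      simp only [add_zero] at h
      rw [← h, lineDeriv]
      simp only [add_smul, add_assoc]
    simp only [score, Sum.elim_inl, scoreθ, smul_zero, add_zero, this]
  · refine M.integral_score_of_line hM hk hkd hθ hη 0 (Pi.single j 1) _ fun s y => ?_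
    have : lineDeriv ℝ (fun η' => M.g k θ η' y) (η + s • Pi.single j 1) (Pi.single j 1) =
        deriv (fun s' : ℝ => M.g k θ (η + s' • Pi.single j 1) y) s := by
      have h := deriv_comp_const_add (f := fun s' : ℝ => M.g k θ (η + s' • Pi.single j 1) y) s 0
      simp only [add_zero] at h
      rw [← h, lineDeriv]
      simp only [add_smul, add_assoc]
    simp only [score, Sum.elim_inr, scoreη, smul_zero, add_zero, this]

/-- The coefficients of the efficient score as a linear combination of the scores. -/
def effCoeff (k : ℕ) (θ : Fin k → ℝ) (η : Fin m → ℝ) : Matrix (Fin k) (Fin k ⊕ Fin m) ℝ :=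
  fromCols 1 (-((M.fisher k θ η).toBlocks₁₂ * ((M.fisher k θ η).toBlocks₂₂)⁻¹))

lemma effScore_eq_mulVec (y : ℝ) :
    M.effScore k θ η y = M.effCoeff k θ η *ᵥ M.score k θ η y := by
  rw [effCoeff, score, fromCols_mulVec_sumElim, one_mulVec, neg_mulVec, effScore, sub_eq_add_neg]

lemma effScore_apply (y : ℝ) (i : Fin k) :
    M.effScore k θ η y i = ∑ a, M.effCoeff k θ η i a * M.score k θ η y a := by
  rw [effScore_eq_mulVec]
  rfl

lemma memLp_effScore (hM : M.Regular) (hk : 1 ≤ k) (hkd : k ≤ d) (hθ : θ ∈ M.Θ k)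
    (hη : η ∈ M.Λ) (i : Fin k) : MemLp (fun y => M.effScore k θ η y i) 2 (M.G k θ η) := by
  simp_rw [effScore_apply]
  exact memLp_finsetSum _ fun a _ => ((hM k hk hkd).2.1 θ hθ η hη a).const_mul _

lemma integral_effScore (hM : M.Regular) (hk : 1 ≤ k) (hkd : k ≤ d) (hθ : θ ∈ M.Θ k)
    (hη : η ∈ M.Λ) (i : Fin k) : ∫ y, M.effScore k θ η y i ∂(M.G k θ η) = 0 := by
  have := M.isProbabilityMeasure_G hk hkd hθ hη
  simp_rw [effScore_apply]
  rw [integral_finsetSum]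
  · simp [integral_const_mul, M.integral_score hM hk hkd hθ hη]
  · exact fun a _ => (((hM k hk hkd).2.1 θ hθ η hη a).integrable (by norm_num)).const_mul _

end Model

/-! ### Second moments and definiteness of the efficient information -/

/-- The matrix of second moments of a random vector. -/
def secondMoment {α ι : Type*} [MeasurableSpace α] (μ : Measure α) (v : α → ι → ℝ) :
    Matrix ι ι ℝ :=
  Matrix.of fun i j => ∫ y, v y i * v y j ∂μ

section SecondMoment

variable {α ι : Type*} [MeasurableSpace α] {μ : Measure α} [Fintype ι] {v : α → ι → ℝ}

lemma integral_sq_dotProduct (hv : ∀ i, MemLp (fun y => v y i) 2 μ) (x : ι → ℝ) :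
    ∫ y, (x ⬝ᵥ v y) ^ 2 ∂μ = x ⬝ᵥ secondMoment μ v *ᵥ x := by
  have hint : ∀ i j, Integrable (fun y => v y i * v y j) μ := fun i j =>
    (hv i).integrable_mul (hv j)
  have : ∀ y, (x ⬝ᵥ v y) ^ 2 = ∑ i, ∑ j, x i * x j * (v y i * v y j) := by
    intro y
    rw [sq, dotProduct, Finset.sum_mul_sum]
    exact Finset.sum_congr rfl fun i _ => Finset.sum_congr rfl fun j _ => by ring
  simp_rw [this]
  rw [integral_finsetSum _ fun i _ => integrable_finsetSum _ fun j _ => (hint i j).const_mul _]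
  simp only [dotProduct, mulVec, Finset.mul_sum, secondMoment, of_apply]
  refine Finset.sum_congr rfl fun i _ => ?_
  rw [integral_finsetSum _ fun j _ => (hint i j).const_mul _]
  refine Finset.sum_congr rfl fun j _ => ?_
  rw [integral_const_mul]
  ring

lemma posSemidef_secondMoment (hv : ∀ i, MemLp (fun y => v y i) 2 μ) :
    (secondMoment μ v).PosSemidef := by
  refine PosSemidef.of_dotProduct_mulVec_nonneg ?_ fun x => ?_
  · ext i j
    simp [secondMoment, conjTranspose_apply, mul_comm]
  · rw [star_trivial, ← integral_sq_dotProduct hv]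
    exact integral_nonneg fun _ => sq_nonneg _

end SecondMoment

namespace Model

variable {d m : ℕ} (M : Model d m) {k : ℕ} {θ : Fin k → ℝ} {η : Fin m → ℝ}

lemma effFisher_eq_secondMoment :
    M.effFisher k θ η = secondMoment (M.G k θ η) (M.effScore k θ η) := rfl

lemma posDef_fisher (hM : M.Regular) (hk : 1 ≤ k) (hkd : k ≤ d) (hθ : θ ∈ M.Θ k)
    (hη : η ∈ M.Λ) : (M.fisher k θ η).PosDef := by
  obtain ⟨-, hL2, hdet, -⟩ := hM k hk hkd
  have h : (M.fisher k θ η).PosSemidef :=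
    posSemidef_secondMoment (v := M.score k θ η) (hL2 θ hθ η hη)
  exact h.posDef_iff_isUnit.2 ((isUnit_iff_isUnit_det _).2 (hdet θ hθ η hη))

/-- The efficient information is positive definite. -/
theorem posDef_effFisher (hM : M.Regular) (hk : 1 ≤ k) (hkd : k ≤ d) (hθ : θ ∈ M.Θ k)
    (hη : η ∈ M.Λ) : (M.effFisher k θ η).PosDef := by
  have hv := M.memLp_effScore hM hk hkd hθ hη
  refine PosDef.of_dotProduct_mulVec_pos (posSemidef_secondMoment hv).1 fun x hx => ?_
  rw [star_trivial, effFisher_eq_secondMoment, ← integral_sq_dotProduct hv]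
  -- The identity block of `effCoeff` reproduces `x`, so a nonzero combination of efficient scores
  -- is a nonzero combination of scores.
  have hne : x ᵥ* M.effCoeff k θ η ≠ 0 := by
    intro h0
    refine hx (funext fun i => ?_)
    have := congrFun h0 (Sum.inl i)
    simpa [effCoeff, vecMul_fromCols] using this
  have hpos := (M.posDef_fisher hM hk hkd hθ hη).dotProduct_mulVec_pos hne
  rw [star_trivial] at hpos
  refine hpos.trans_eq ?_
  rw [show M.fisher k θ η = secondMoment (M.G k θ η) (M.score k θ η) from rfl,
    ← integral_sq_dotProduct ((hM k hk hkd).2.1 θ hθ η hη)]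
  simp_rw [effScore_eq_mulVec, dotProduct_mulVec]

end Model

open scoped MatrixOrder

/-! ### An infinite sequence of observations -/

/-- The law of an infinite sequence of independent observations with law `μ`. -/
def seqLaw (μ : Measure ℝ) : Measure (ℕ → ℝ) := Measure.infinitePi fun _ => μ

/-- The first `n` terms of a sequence of observations. -/
def firstObs (n : ℕ) (ω : ℕ → ℝ) : Fin n → ℝ := fun i => ω i

lemma measurable_firstObs (n : ℕ) : Measurable (firstObs n) :=
  measurable_pi_lambda _ fun _ => measurable_pi_apply _

section SeqLaw

variable (μ : Measure ℝ) [IsProbabilityMeasure μ]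

instance : IsProbabilityMeasure (seqLaw μ) := by unfold seqLaw; infer_instance

lemma measurePreserving_eval_seqLaw (i : ℕ) :
    MeasurePreserving (Function.eval i) (seqLaw μ) μ :=
  measurePreserving_eval_infinitePi (fun _ => μ) i

lemma map_eval_seqLaw (i : ℕ) : (seqLaw μ).map (fun ω => ω i) = μ :=
  (measurePreserving_eval_seqLaw μ i).map_eq

lemma iIndepFun_eval_seqLaw : iIndepFun (fun (i : ℕ) (ω : ℕ → ℝ) => ω i) (seqLaw μ) :=
  iIndepFun_infinitePi (P := fun _ : ℕ => μ) (X := fun _ => id) fun _ => measurable_id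

lemma identDistrib_eval_seqLaw (i j : ℕ) :
    IdentDistrib (fun ω : ℕ → ℝ => ω i) (fun ω => ω j) (seqLaw μ) (seqLaw μ) :=
  ⟨(measurable_pi_apply i).aemeasurable, (measurable_pi_apply j).aemeasurable, by
    rw [map_eval_seqLaw, map_eval_seqLaw]⟩

/-- Samples of different sizes live on different spaces; this realizes them all on one, where the
limit theorems apply. -/
lemma map_firstObs (n : ℕ) : (seqLaw μ).map (firstObs n) = sampleLaw μ n := by
  have h := (iIndepFun_eval_seqLaw μ).precomp (Fin.val_injective (n := n))
  rw [iIndepFun_iff_map_fun_eq_pi_map fun i => (measurable_pi_apply _).aemeasurable] at h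
  simp only [map_eval_seqLaw] at h
  exact h

lemma sampleLaw_apply {n : ℕ} {s : Set (Fin n → ℝ)} (hs : MeasurableSet s) :
    sampleLaw μ n s = seqLaw μ (firstObs n ⁻¹' s) := by
  rw [← map_firstObs, Measure.map_apply (measurable_firstObs n) hs]

/-- One inequality needs no measurability of `s`, which is not known for the error events of the
score estimators. -/
lemma seqLaw_preimage_le (n : ℕ) (s : Set (Fin n → ℝ)) :
    seqLaw μ (firstObs n ⁻¹' s) ≤ sampleLaw μ n s := by
  rw [← map_firstObs]
  exact Measure.le_map_apply (measurable_firstObs n).aemeasurable s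

lemma tendsto_seqLaw_preimage {s : (n : ℕ) → Set (Fin n → ℝ)}
    (h : Tendsto (fun n => sampleLaw μ n (s n)) atTop (𝓝 0)) :
    Tendsto (fun n => seqLaw μ (firstObs n ⁻¹' s n)) atTop (𝓝 0) :=
  tendsto_of_tendsto_of_tendsto_of_le_of_le tendsto_const_nhds h (fun _ => zero_le)
    fun n => seqLaw_preimage_le μ n (s n)

variable {μ}

lemma aemeasurable_comp_eval {β : Type*} [MeasurableSpace β] {u : ℝ → β} (hu : AEMeasurable u μ)
    (i : ℕ) : AEMeasurable (fun ω : ℕ → ℝ => u (ω i)) (seqLaw μ) :=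
  hu.comp_quasiMeasurePreserving (measurePreserving_eval_seqLaw μ i).quasiMeasurePreserving

lemma identDistrib_comp_eval {u : ℝ → ℝ} (hu : AEMeasurable u μ) (i j : ℕ) :
    IdentDistrib (fun ω : ℕ → ℝ => u (ω i)) (fun ω => u (ω j)) (seqLaw μ) (seqLaw μ) :=
  (identDistrib_eval_seqLaw μ i j).comp_of_aemeasurable (by rwa [map_eval_seqLaw])

lemma iIndepFun_comp_eval {u : ℝ → ℝ} (hu : AEMeasurable u μ) :
    iIndepFun (fun (i : ℕ) (ω : ℕ → ℝ) => u (ω i)) (seqLaw μ) :=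
  (iIndepFun_eval_seqLaw μ).comp₀ (fun _ => u)
    (fun i => (measurable_pi_apply i).aemeasurable) fun i => by rwa [map_eval_seqLaw]

lemma integral_comp_eval_seqLaw {u : ℝ → ℝ} (hu : AEMeasurable u μ) (i : ℕ) :
    ∫ ω, u (ω i) ∂(seqLaw μ) = ∫ y, u y ∂μ := by
  conv_rhs => rw [← map_eval_seqLaw μ i]
  rw [integral_map (measurable_pi_apply i).aemeasurable]
  rw [map_eval_seqLaw]
  exact hu.aestronglyMeasurable

/-- The weak law of large numbers. -/
lemma tendsto_average {u : ℝ → ℝ} (hu : Integrable u μ) {ε : ℝ} (hε : 0 < ε) :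
    Tendsto (fun n : ℕ => seqLaw μ {ω | ε ≤ |(n : ℝ)⁻¹ * ∑ i ∈ Finset.range n, u (ω i) -
      ∫ y, u y ∂μ|}) atTop (𝓝 0) := by
  have hlln := strong_law_ae (μ := seqLaw μ) (fun (i : ℕ) (ω : ℕ → ℝ) => u (ω i))
    ((measurePreserving_eval_seqLaw μ 0).integrable_comp_of_integrable hu)
    (fun i j hij => (iIndepFun_comp_eval hu.aemeasurable).indepFun hij)
    (fun i => identDistrib_comp_eval hu.aemeasurable i 0)
  rw [integral_comp_eval_seqLaw hu.aemeasurable] at hlln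
  have hmeas : ∀ n : ℕ, AEStronglyMeasurable
      (fun ω : ℕ → ℝ => (n : ℝ)⁻¹ • ∑ i ∈ Finset.range n, u (ω i)) (seqLaw μ) := fun n =>
    ((Finset.aemeasurable_fun_sum _ fun i _ =>
      aemeasurable_comp_eval hu.aemeasurable i).const_mul _).aestronglyMeasurable
  exact tendstoInMeasure_iff_norm.1 (tendstoInMeasure_of_tendsto_ae hmeas hlln) ε hε

/-- The multivariate central limit theorem. -/
theorem tendstoInDistribution_sum {k : ℕ} {v : ℝ → Fin k → ℝ}
    (hv : ∀ i, MemLp (fun y => v y i) 2 μ) (h0 : ∀ i, ∫ y, v y i ∂μ = 0) :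
    TendstoInDistribution
      (fun (n : ℕ) (ω : ℕ → ℝ) => WithLp.toLp 2 ((√n)⁻¹ • ∑ i ∈ Finset.range n, v (ω i)))
      atTop id (fun _ => seqLaw μ) (multivariateGaussian 0 (secondMoment μ v)) := by
  have hva : AEMeasurable v μ := aemeasurable_pi_iff.2 fun i => (hv i).aemeasurable
  have hX : ∀ n : ℕ, AEMeasurable
      (fun ω : ℕ → ℝ => WithLp.toLp 2 ((√n)⁻¹ • ∑ i ∈ Finset.range n, v (ω i))) (seqLaw μ) :=
    fun n => by
      have hsum : AEMeasurable (fun ω : ℕ → ℝ => ∑ i ∈ Finset.range n, v (ω i)) (seqLaw μ) :=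
        Finset.aemeasurable_fun_sum _ fun i _ => aemeasurable_comp_eval hva i
      have hc : Measurable fun x : Fin k → ℝ => WithLp.toLp 2 ((√n)⁻¹ • x) :=
        Continuous.measurable (by fun_prop)
      exact hc.comp_aemeasurable hsum
  refine ⟨hX, aemeasurable_id, ProbabilityMeasure.tendsto_iff_tendsto_charFun.2 fun t => ?_⟩
  -- Cramér–Wold: the characteristic function of the vector at `t` is that of the normalized sum of
  -- `u` at 1. The covariance may be singular.
  set u : ℝ → ℝ := fun y => t.ofLp ⬝ᵥ v y with hu
  have hu2 : MemLp u 2 μ := memLp_finsetSum _ fun i _ => (hv i).const_mul _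
  have hu0 : ∫ y, u y ∂μ = 0 := by
    simp only [hu, dotProduct]
    rw [integral_finsetSum _ fun i _ => ((hv i).integrable (by norm_num)).const_mul _]
    simp [integral_const_mul, h0]
  have hvar : Var[fun ω : ℕ → ℝ => u (ω 0); seqLaw μ] =
      t.ofLp ⬝ᵥ secondMoment μ v *ᵥ t.ofLp := by
    rw [variance_of_integral_eq_zero (aemeasurable_comp_eval hu2.aemeasurable 0)
      (by rw [integral_comp_eval_seqLaw hu2.aemeasurable, hu0]),
      integral_comp_eval_seqLaw (u := fun y => u y ^ 2) (hu2.aemeasurable.pow_const 2),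
      ← integral_sq_dotProduct hv]
  have hclt := tendstoInDistribution_inv_sqrt_mul_sum_sub (P := seqLaw μ)
    (X := fun (i : ℕ) (ω : ℕ → ℝ) => u (ω i)) (Y := id)
    (P' := gaussianReal 0 Var[fun ω : ℕ → ℝ => u (ω 0); seqLaw μ].toNNReal) HasLaw.id
    (hu2.comp_measurePreserving (measurePreserving_eval_seqLaw μ 0))
    (iIndepFun_comp_eval hu2.aemeasurable)
    (fun i => identDistrib_comp_eval hu2.aemeasurable i 0)
  have hlim := ProbabilityMeasure.tendsto_iff_tendsto_charFun.1 hclt.tendsto 1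
  simp only [ProbabilityMeasure.coe_mk, Measure.map_id, charFun_gaussianReal,
    integral_comp_eval_seqLaw hu2.aemeasurable, hu0] at hlim
  simp only [ProbabilityMeasure.coe_mk, Measure.map_id,
    charFun_multivariateGaussian (posSemidef_secondMoment hv)]
  convert hlim using 2 with n
  · rw [charFun_apply, charFun_apply, integral_map (hX n) (by fun_prop), integral_map]
    · refine integral_congr_ae (ae_of_all _ fun ω => ?_)
      simp only [EuclideanSpace.inner_eq_star_dotProduct, star_trivial, hu,
        dotProduct_smul, dotProduct_sum]
      simp
    · exact (((Finset.aemeasurable_fun_sum _ fun i _ =>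
        aemeasurable_comp_eval hu2.aemeasurable i).sub_const _).const_mul _)
    · fun_prop
  · have hnn : 0 ≤ t.ofLp ⬝ᵥ secondMoment μ v *ᵥ t.ofLp := by
      rw [← integral_sq_dotProduct hv]
      exact integral_nonneg fun _ => sq_nonneg _
    rw [hvar, Real.coe_toNNReal _ hnn]
    simp

end SeqLaw

/-! ### Convergence in distribution and probabilities of sets -/

section Distribution

variable {Ω Ω' : Type*} [MeasurableSpace Ω] [MeasurableSpace Ω'] {P : Measure Ω}
  [IsProbabilityMeasure P] {P' : Measure Ω'} [IsProbabilityMeasure P'] {T : ℕ → Ω → ℝ} {Z : Ω' → ℝ}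

lemma limsup_measure_closed_le (h : TendstoInDistribution T atTop Z (fun _ => P) P') {F : Set ℝ}
    (hF : IsClosed F) : limsup (fun n => P (T n ⁻¹' F)) atTop ≤ P' (Z ⁻¹' F) := by
  have := ProbabilityMeasure.limsup_measure_closed_le_of_tendsto h.tendsto hF
  simp only [ProbabilityMeasure.coe_mk] at this
  rw [Measure.map_apply_of_aemeasurable h.aemeasurable_limit hF.measurableSet] at this
  simpa only [Measure.map_apply_of_aemeasurable (h.forall_aemeasurable _) hF.measurableSet]
    using this

lemma tendsto_measure_Ioi (h : TendstoInDistribution T atTop Z (fun _ => P) P') {c : ℝ}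
    (hc : P' (Z ⁻¹' {c}) = 0) :
    Tendsto (fun n => P (T n ⁻¹' Ioi c)) atTop (𝓝 (P' (Z ⁻¹' Ioi c))) := by
  have := ProbabilityMeasure.tendsto_measure_of_null_frontier_of_tendsto' h.tendsto (E := Ioi c)
    (by
      rw [frontier_Ioi, ProbabilityMeasure.coe_mk,
        Measure.map_apply_of_aemeasurable h.aemeasurable_limit (measurableSet_singleton c), hc])
  simp only [ProbabilityMeasure.coe_mk] at this
  rw [Measure.map_apply_of_aemeasurable h.aemeasurable_limit measurableSet_Ioi] at this
  simpa only [Measure.map_apply_of_aemeasurable (h.forall_aemeasurable _) measurableSet_Ioi]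
    using this

/-- A sequence that converges in distribution is tight. -/
lemma tendsto_measure_abs_ge (h : TendstoInDistribution T atTop Z (fun _ => P) P') {a : ℕ → ℝ}
    (ha : Tendsto a atTop atTop) : Tendsto (fun n => P {ω | a n ≤ |T n ω|}) atTop (𝓝 0) := by
  -- By Slutsky `T n / a n` tends to 0, and the closed set `1 ≤ |x|` does not contain 0.
  have hY : TendstoInMeasure P (fun n (_ : Ω) => (a n)⁻¹) atTop fun _ => 0 :=
    tendstoInMeasure_of_tendsto_ae (fun n => aestronglyMeasurable_const)
      (ae_of_all _ fun _ => tendsto_inv_atTop_zero.comp ha)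
  have hlim := h.continuous_comp_prodMk_of_tendstoInMeasure_const
    (g := fun p : ℝ × ℝ => p.1 * p.2) (by fun_prop) hY fun _ => aemeasurable_const
  have hF : IsClosed {x : ℝ | 1 ≤ |x|} := isClosed_le continuous_const continuous_abs
  have hle := limsup_measure_closed_le hlim hF
  simp only [mul_zero, preimage_ofPred_eq, abs_zero, not_le.2 one_pos, ofPred_false, measure_empty,
    nonpos_iff_eq_zero] at hle
  have h0 : Tendsto (fun n => P {ω | 1 ≤ |T n ω * (a n)⁻¹|}) atTop (𝓝 0) :=
    tendsto_of_le_liminf_of_limsup_le zero_le hle.le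
  refine h0.congr' ?_
  filter_upwards [ha.eventually_gt_atTop 0] with n hn
  congr 1 with ω
  rw [mem_ofPred_eq, mem_ofPred_eq, ← div_eq_mul_inv, abs_div, abs_of_pos hn, one_le_div hn]

end Distribution

/-! ### Quadratic forms of Gaussian vectors and the chi-square distribution -/

section ChiSquare

lemma measurable_sum_sq (k : ℕ) : Measurable fun z : Fin k → ℝ => ∑ i, z i ^ 2 := by fun_prop

instance (k : ℕ) : IsProbabilityMeasure (chiSq k) :=
  Measure.isProbabilityMeasure_map (measurable_sum_sq k).aemeasurable

/-- Given the other coordinates, the first one is confined to at most two square roots, and a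
Gaussian law has no atoms. For `k = 0` the law is a point mass. -/
lemma chiSq_singleton {k : ℕ} (hk : 1 ≤ k) (c : ℝ) : chiSq k {c} = 0 := by
  obtain ⟨k, rfl⟩ : ∃ k', k = k' + 1 := ⟨k - 1, by omega⟩
  have hm : MeasurableSet {p : (Fin k → ℝ) × ℝ | p.2 ^ 2 + ∑ i, p.1 i ^ 2 = c} :=
    measurableSet_eq_fun (by fun_prop) measurable_const
  have hmp := measurePreserving_piFinSuccAbove (fun _ : Fin (k + 1) => gaussianReal 0 1) 0
  rw [chiSq, Measure.map_apply (measurable_sum_sq _) (measurableSet_singleton c)]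
  have heq : (fun z : Fin (k + 1) → ℝ => ∑ i, z i ^ 2) ⁻¹' {c} =
      MeasurableEquiv.piFinSuccAbove (fun _ => ℝ) 0 ⁻¹'
        (Prod.swap ⁻¹' {p : (Fin k → ℝ) × ℝ | p.2 ^ 2 + ∑ i, p.1 i ^ 2 = c}) := by
    ext z
    simp [Fin.sum_univ_succ, MeasurableEquiv.piFinSuccAbove, Fin.tail]
  rw [heq, hmp.measure_preimage (hm.preimage measurable_swap).nullMeasurableSet,
    ← Measure.map_apply measurable_swap hm, Measure.prod_swap, Measure.measure_prod_null hm]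
  refine ae_of_all _ fun z => ?_
  have hfin : (Prod.mk z ⁻¹' {p : (Fin k → ℝ) × ℝ | p.2 ^ 2 + ∑ i, p.1 i ^ 2 = c}).Finite := by
    refine Set.Finite.subset (Set.toFinite {√(c - ∑ i, z i ^ 2), -√(c - ∑ i, z i ^ 2)})
      fun x hx => ?_
    have hx' : x ^ 2 = c - ∑ i, z i ^ 2 := by
      have : x ^ 2 + ∑ i, z i ^ 2 = c := hx
      linarith
    have : |x| = √(c - ∑ i, z i ^ 2) := by rw [← hx', Real.sqrt_sq_eq_abs]
    simpa [this] using eq_or_eq_neg_of_abs_eq this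
  have := nullSingletonClass_gaussianReal (μ := 0) (v := 1) one_ne_zero
  exact hfin.measure_zero _

/-- A threshold `c ≤ 0` would be exceeded with probability one. Positivity leaves room below `c` for
the inconsistency claim. -/
lemma pos_of_isCritical_chiSq {k : ℕ} (hk : 1 ≤ k) {α c : ℝ} (hα : α < 1)
    (hc : IsCritical (chiSq k) α c) : 0 < c := by
  by_contra! hcon
  have h1 : chiSq k (Iic c) = 0 := by
    refine measure_mono_null (t := Iio 0 ∪ {0}) (fun x hx => ?_)
      (measure_union_null ?_ (chiSq_singleton hk 0))
    · exact (lt_or_eq_of_le ((show x ≤ c from hx).trans hcon)).imp id id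
    · rw [chiSq, Measure.map_apply (measurable_sum_sq _) measurableSet_Iio]
      convert measure_empty (μ := Measure.pi fun _ : Fin k => gaussianReal 0 1)
      ext z
      simpa using Finset.sum_nonneg fun i _ => sq_nonneg (z i)
  have h2 : chiSq k (Ioi c) = 1 := by
    rw [← compl_Iic, prob_compl_eq_one_iff measurableSet_Iic, h1]
  rw [IsCritical, h2] at hc
  have := ENNReal.ofReal_lt_one.2 hα
  exact this.ne hc.symm

/-- The quadratic form of a matrix. -/
def quadForm {k : ℕ} (A : Matrix (Fin k) (Fin k) ℝ) (z : EuclideanSpace ℝ (Fin k)) : ℝ :=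
  z.ofLp ⬝ᵥ A *ᵥ z.ofLp

lemma continuous_quadForm {k : ℕ} (A : Matrix (Fin k) (Fin k) ℝ) : Continuous (quadForm A) := by
  unfold quadForm
  fun_prop

lemma multivariateGaussian_zero_eq {k : ℕ} (S : Matrix (Fin k) (Fin k) ℝ) :
    multivariateGaussian 0 S = (Measure.pi fun _ : Fin k => gaussianReal 0 1).map
      fun x => WithLp.toLp 2 (CFC.sqrt S *ᵥ x) := by
  rw [multivariateGaussian, ← map_pi_eq_stdGaussian, Measure.map_map (by fun_prop) (by fun_prop)]
  congr 1
  ext x : 1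
  simp [toEuclideanCLM_toLp]

/-- The squared Mahalanobis norm of a Gaussian vector has a chi-square distribution. -/
theorem map_quadForm_inv {k : ℕ} {S : Matrix (Fin k) (Fin k) ℝ} (hS : S.PosDef) :
    (multivariateGaussian 0 S).map (quadForm S⁻¹) = chiSq k := by
  have hcont : Continuous fun x : Fin k → ℝ => WithLp.toLp 2 (CFC.sqrt S *ᵥ x) := by fun_prop
  rw [multivariateGaussian_zero_eq, Measure.map_map (continuous_quadForm _).measurable
    hcont.measurable, chiSq]
  congr 1
  ext x
  -- `B` is symmetric and invertible with `B * B = S`, so the form at `B x` has matrix `B * S⁻¹ * B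
  -- = 1`.
  set B := CFC.sqrt S with hB
  have hBB : B * B = S := CFC.sqrt_mul_sqrt_self S hS.posSemidef.nonneg
  have hBt : Bᵀ = B := by
    have : Bᴴ = B := (CFC.sqrt_nonneg S).isSelfAdjoint
    rwa [conjTranspose_eq_transpose_of_trivial] at this
  have hBu : IsUnit B.det := by
    have : IsUnit (B * B).det := by
      rw [hBB]
      exact hS.det_pos.ne'.isUnit
    rw [det_mul] at this
    exact isUnit_of_mul_isUnit_left this
  have h1 : B * S⁻¹ * B = 1 := by
    rw [← hBB, Matrix.mul_inv_rev, ← mul_assoc, mul_nonsing_inv _ hBu, one_mul, nonsing_inv_mul _ hBu]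
  have h2 : B *ᵥ x ⬝ᵥ S⁻¹ *ᵥ B *ᵥ x = x ⬝ᵥ (B * S⁻¹ * B) *ᵥ x := by
    nth_rewrite 1 [← hBt]
    rw [mulVec_transpose, ← dotProduct_mulVec, mulVec_mulVec, mulVec_mulVec, mul_assoc]
  simp only [Function.comp_apply, quadForm]
  rw [h2, h1, one_mulVec]
  simp only [dotProduct, sq]

instance : (gaussianReal 0 1).IsOpenPosMeasure :=
  (gaussianReal_absolutelyContinuous' 0 one_ne_zero).isOpenPosMeasure

/-- In standard Gaussian coordinates the event is open and contains the origin. Under an alternative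
the covariance may be singular, so `S` is arbitrary. -/
lemma multivariateGaussian_quadForm_lt_pos {k : ℕ} (S A : Matrix (Fin k) (Fin k) ℝ) {c : ℝ}
    (hc : 0 < c) : 0 < multivariateGaussian 0 S (quadForm A ⁻¹' Iio c) := by
  have hcont : Continuous fun x : Fin k → ℝ => WithLp.toLp 2 (CFC.sqrt S *ᵥ x) := by fun_prop
  have ho : IsOpen (quadForm A ⁻¹' Iio c) := isOpen_Iio.preimage (continuous_quadForm A)
  rw [multivariateGaussian_zero_eq, Measure.map_apply hcont.measurable ho.measurableSet]
  refine (ho.preimage hcont).measure_pos _ ⟨0, ?_⟩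
  simpa [quadForm] using hc

end ChiSquare

/-! ### Vanishing probabilities and coercivity of quadratic forms -/

lemma tendsto_measure_zero_mono {Ω : ℕ → Type*} [∀ n, MeasurableSpace (Ω n)]
    {P : ∀ n, Measure (Ω n)} {s t : ∀ n, Set (Ω n)} (h : ∀ᶠ n in atTop, s n ⊆ t n)
    (ht : Tendsto (fun n => P n (t n)) atTop (𝓝 0)) :
    Tendsto (fun n => P n (s n)) atTop (𝓝 0) :=
  tendsto_of_tendsto_of_tendsto_of_le_of_le' tendsto_const_nhds ht
    (Eventually.of_forall fun _ => zero_le) (h.mono fun _ hn => measure_mono hn)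

lemma tendsto_measure_zero_union {Ω : ℕ → Type*} [∀ n, MeasurableSpace (Ω n)]
    {P : ∀ n, Measure (Ω n)} {s t : ∀ n, Set (Ω n)}
    (hs : Tendsto (fun n => P n (s n)) atTop (𝓝 0))
    (ht : Tendsto (fun n => P n (t n)) atTop (𝓝 0)) :
    Tendsto (fun n => P n (s n ∪ t n)) atTop (𝓝 0) := by
  have := hs.add ht
  rw [add_zero] at this
  exact tendsto_of_tendsto_of_tendsto_of_le_of_le tendsto_const_nhds this (fun _ => zero_le)
    fun _ => measure_union_le _ _

lemma tendsto_measure_zero_iUnion {Ω : ℕ → Type*} [∀ n, MeasurableSpace (Ω n)] {ι : Type*}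
    [Fintype ι] {P : ∀ n, Measure (Ω n)} {s : ι → ∀ n, Set (Ω n)}
    (hs : ∀ i, Tendsto (fun n => P n (s i n)) atTop (𝓝 0)) :
    Tendsto (fun n => P n (⋃ i, s i n)) atTop (𝓝 0) := by
  have := tendsto_finsetSum Finset.univ fun i _ => hs i
  rw [Finset.sum_const_zero] at this
  exact tendsto_of_tendsto_of_tendsto_of_le_of_le tendsto_const_nhds this (fun _ => zero_le)
    fun _ => measure_iUnion_fintype_le _ _

/-- Quadratic forms of matrices near a positive definite matrix are uniformly coercive. -/
lemma exists_coercive {k : ℕ} {A : Matrix (Fin k) (Fin k) ℝ} (hA : A.PosDef) :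
    ∃ lam > 0, ∃ δ > 0, ∀ B : Matrix (Fin k) (Fin k) ℝ, (∀ i j, |B i j - A i j| < δ) →
      ∀ (x : Fin k → ℝ) (i : Fin k), lam * x i ^ 2 ≤ x ⬝ᵥ B *ᵥ x := by
  rcases isEmpty_or_nonempty (Fin k) with he | hne
  · exact ⟨1, one_pos, 1, one_pos, fun _ _ _ i => he.elim i⟩
  have hcont : Continuous fun x : Fin k → ℝ => x ⬝ᵥ A *ᵥ x := by fun_prop
  obtain ⟨x₀, hx₀, hmin⟩ := (isCompact_sphere (0 : Fin k → ℝ) 1).exists_isMinOn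
    (NormedSpace.sphere_nonempty.2 zero_le_one) hcont.continuousOn
  have hx₀1 : ‖x₀‖ = 1 := by simpa using hx₀
  set c : ℝ := x₀ ⬝ᵥ A *ᵥ x₀ with hc
  have hcpos : 0 < c := by
    have := hA.dotProduct_mulVec_pos (x := x₀) (by
      rintro rfl
      simp at hx₀1)
    rwa [star_trivial] at this
  have hcoer : ∀ x : Fin k → ℝ, c * ‖x‖ ^ 2 ≤ x ⬝ᵥ A *ᵥ x := by
    intro x
    rcases eq_or_ne x 0 with rfl | hx
    · simp
    have hx' : 0 < ‖x‖ := norm_pos_iff.2 hx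
    have h1 := hmin (show ‖x‖⁻¹ • x ∈ Metric.sphere (0 : Fin k → ℝ) 1 by
      simp [norm_smul, hx'.ne'])
    simp only [mem_ofPred_eq, mulVec_smul, smul_dotProduct, dotProduct_smul, smul_eq_mul] at h1
    have h2 : ‖x‖⁻¹ * (‖x‖⁻¹ * x ⬝ᵥ A *ᵥ x) = (x ⬝ᵥ A *ᵥ x) / ‖x‖ ^ 2 := by field_simp
    rw [h2, le_div_iff₀ (by positivity)] at h1
    exact h1
  -- The `k²` entrywise errors, each below `c / 2 / N`, together cost at most half of the coercivity
  -- constant `c`.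
  set N : ℝ := (k : ℝ) * k + 1 with hN
  have hNpos : 0 < N := by positivity
  refine ⟨c / 2, by positivity, c / 2 / N, by positivity, fun B hB x i => ?_⟩
  have hdiff : |x ⬝ᵥ (B - A) *ᵥ x| ≤ c / 2 * ‖x‖ ^ 2 := by
    calc |x ⬝ᵥ (B - A) *ᵥ x| = |∑ i, ∑ j, x i * ((B - A) i j * x j)| := by
          simp only [dotProduct, mulVec, Finset.mul_sum]
      _ ≤ ∑ i : Fin k, ∑ j : Fin k, ‖x‖ * (c / 2 / N * ‖x‖) := by
          refine (Finset.abs_sum_le_sum_abs _ _).trans (Finset.sum_le_sum fun i _ => ?_)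
          refine (Finset.abs_sum_le_sum_abs _ _).trans (Finset.sum_le_sum fun j _ => ?_)
          rw [abs_mul, abs_mul]
          have h1 := (hB i j).le
          have h2 : |x i| ≤ ‖x‖ := norm_le_pi_norm x i
          have h3 : |x j| ≤ ‖x‖ := norm_le_pi_norm x j
          rw [Matrix.sub_apply]
          gcongr
      _ = (k : ℝ) * k / N * (c / 2 * ‖x‖ ^ 2) := by
          simp only [Finset.sum_const, Finset.card_univ, Fintype.card_fin, nsmul_eq_mul]
          ring
      _ ≤ 1 * (c / 2 * ‖x‖ ^ 2) := by
          have : (k : ℝ) * k / N ≤ 1 := by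
            rw [div_le_one hNpos]
            linarith
          gcongr
      _ = c / 2 * ‖x‖ ^ 2 := one_mul _
  have hsplit : x ⬝ᵥ B *ᵥ x = x ⬝ᵥ A *ᵥ x + x ⬝ᵥ (B - A) *ᵥ x := by
    rw [sub_mulVec, dotProduct_sub]
    ring
  have hxi : x i ^ 2 ≤ ‖x‖ ^ 2 := by
    rw [← sq_abs]
    exact pow_le_pow_left₀ (abs_nonneg _) (norm_le_pi_norm x i) 2
  rw [hsplit]
  have h1 := neg_le_of_abs_le hdiff
  have h2 := hcoer x
  have h3 : c / 2 * x i ^ 2 ≤ c / 2 * ‖x‖ ^ 2 := by gcongr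
  linarith

/-! ### Asymptotics of the statistics of fixed dimension -/

namespace Estimators

variable (E : Estimators) {d m : ℕ} (M : Model d m) {k : ℕ} {η : Fin m → ℝ} {μ : Measure ℝ}

lemma measurable_normalizedSum (k n : ℕ) : Measurable (E.normalizedSum k n) := by
  refine measurable_pi_lambda _ fun i => ?_
  simp only [normalizedSum, Pi.smul_apply, Finset.sum_apply]
  exact (Finset.measurable_fun_sum _ fun j _ => E.measurable_l k n j i).const_mul _

lemma measurable_W (k n : ℕ) : Measurable (E.W k n) := by
  have h := E.measurable_normalizedSum k n
  have hi : ∀ i, Measurable fun y => E.normalizedSum k n y i := fun i =>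
    (measurable_pi_apply i).comp h
  unfold W
  simp only [dotProduct, mulVec]
  exact Finset.measurable_fun_sum _ fun i _ => (hi i).mul
    (Finset.measurable_fun_sum _ fun j _ => (E.measurable_L k n i j).mul (hi j))

variable {E M}

/-- The asymptotic distribution of the test statistic at a law with centred efficient score. -/
theorem tendstoInDistribution_W [IsProbabilityMeasure μ]
    (hv : ∀ i, MemLp (fun y => M.effScoreNull k η y i) 2 μ)
    (h0 : ∀ i, ∫ y, M.effScoreNull k η y i ∂μ = 0)
    (hS : E.SufficientlyGood M k η μ) (hL : E.InformationConsistent M k η μ) :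
    TendstoInDistribution (fun (n : ℕ) (ω : ℕ → ℝ) => E.W k n (firstObs n ω)) atTop
      (quadForm (M.effFisher k (M.null k) η)⁻¹) (fun _ => seqLaw μ)
      (multivariateGaussian 0 (secondMoment μ (M.effScoreNull k η))) := by
  set A := (M.effFisher k (M.null k) η)⁻¹ with hA
  have hclt := tendstoInDistribution_sum hv h0
  have hZ : TendstoInDistribution
      (fun (n : ℕ) (ω : ℕ → ℝ) => WithLp.toLp 2 (E.normalizedSum k n (firstObs n ω)))
      atTop id (fun _ => seqLaw μ)
      (multivariateGaussian 0 (secondMoment μ (M.effScoreNull k η))) := by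
    -- `SufficientlyGood` says exactly that replacing the true efficient scores by the estimated
    -- ones does not change the limit.
    refine tendstoInDistribution_of_tendstoInMeasure_sub _ _ hclt ?_ fun n => ?_
    · refine tendstoInMeasure_iff_norm.2 fun ε hε => ?_
      refine (tendsto_seqLaw_preimage μ (hS ε hε)).congr fun n => ?_
      congr 1 with ω
      have hω : ((fun (n : ℕ) (ω : ℕ → ℝ) => WithLp.toLp 2 (E.normalizedSum k n (firstObs n ω))) -
          fun (n : ℕ) (ω : ℕ → ℝ) =>
            WithLp.toLp 2 ((√n)⁻¹ • ∑ i ∈ Finset.range n, M.effScoreNull k η (ω i))) n ω =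
          (1 / √(n : ℝ)) • WithLp.toLp 2 (∑ j, (E.l k n (firstObs n ω) j -
            M.effScoreNull k η (firstObs n ω j))) := by
        simp only [Pi.sub_apply, normalizedSum, firstObs, Finset.sum_sub_distrib, one_div]
        rw [Finset.sum_range (fun i => M.effScoreNull k η (ω i)), ← WithLp.toLp_sub,
          ← WithLp.toLp_smul, smul_sub]
      simp only [mem_preimage, mem_ofPred_eq, hω, Pi.zero_apply, sub_zero, norm_smul]
      rw [Real.norm_of_nonneg (by positivity)]
    · exact ((WithLp.measurable_toLp 2 _).comp
        ((E.measurable_normalizedSum k n).comp (measurable_firstObs n))).aemeasurable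
  have hLm : TendstoInMeasure (seqLaw μ)
      (fun (n : ℕ) (ω : ℕ → ℝ) (p : Fin k × Fin k) => E.L k n (firstObs n ω) p.1 p.2) atTop
      fun _ p => A p.1 p.2 := by
    refine tendstoInMeasure_iff_norm.2 fun ε hε => ?_
    refine tendsto_measure_zero_mono (Eventually.of_forall fun n => ?_)
      (tendsto_measure_zero_iUnion fun p : Fin k × Fin k =>
        tendsto_seqLaw_preimage μ (hL p.1 p.2 ε hε))
    intro ω hω
    by_contra hcon
    simp only [mem_iUnion, mem_preimage, mem_ofPred_eq, not_exists, not_le] at hcon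
    exact (not_lt.2 hω) ((pi_norm_lt_iff hε).2 hcon)
  have hg : Continuous fun q : EuclideanSpace ℝ (Fin k) × (Fin k × Fin k → ℝ) =>
      q.1.ofLp ⬝ᵥ (Matrix.of fun i j => q.2 (i, j)) *ᵥ q.1.ofLp := by
    simp only [dotProduct, mulVec, of_apply]
    fun_prop
  have := hZ.continuous_comp_prodMk_of_tendstoInMeasure_const hg hLm fun n =>
    (measurable_pi_lambda _ fun p : Fin k × Fin k =>
      (E.measurable_L k n p.1 p.2).comp (measurable_firstObs n)).aemeasurable
  exact this

/-- The asymptotic null distribution of the test statistic. -/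
theorem tendsto_power_W_null (hM : M.Regular) (hk : 1 ≤ k) (hkd : k ≤ d) (hη : η ∈ M.Λ)
    (hE : E.GoodUnderNull M k) (c : ℝ) :
    Tendsto (power (E.W k) c (M.G k (M.null k) η)) atTop (𝓝 (chiSq k (Ioi c))) := by
  have hθ := M.null_mem' hk hkd
  have := M.isProbabilityMeasure_G hk hkd hθ hη
  have hpd := M.posDef_effFisher hM hk hkd hθ hη
  have hW := tendstoInDistribution_W (M.memLp_effScore hM hk hkd hθ hη)
    (M.integral_effScore hM hk hkd hθ hη) (hE η hη).1 (hE η hη).2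
  -- At a null law the covariance of the limit is the matrix inverted in the form, hence a
  -- chi-square limit.
  rw [M.effFisher_eq_secondMoment] at hpd
  have hlaw := map_quadForm_inv hpd
  have hmeas := (continuous_quadForm
    (secondMoment (M.G k (M.null k) η) (M.effScore k (M.null k) η))⁻¹).measurable
  have hlim := tendsto_measure_Ioi hW (c := c) (by
    have := chiSq_singleton hk c
    rwa [← hlaw, Measure.map_apply hmeas (measurableSet_singleton c)] at this)
  rw [← hlaw, Measure.map_apply hmeas measurableSet_Ioi]
  refine hlim.congr fun n => ?_
  exact (sampleLaw_apply _ ((E.measurable_W k n) measurableSet_Ioi)).symm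

lemma tendsto_measure_abs_W_ge_null (hM : M.Regular) (hk : 1 ≤ k) (hkd : k ≤ d) (hη : η ∈ M.Λ)
    (hE : E.GoodUnderNull M k) {a : ℕ → ℝ} (ha : Tendsto a atTop atTop) :
    Tendsto (fun n => sampleLaw (M.G k (M.null k) η) n {y | a n ≤ |E.W k n y|}) atTop (𝓝 0) := by
  have hθ := M.null_mem' hk hkd
  have := M.isProbabilityMeasure_G hk hkd hθ hη
  have hW := tendstoInDistribution_W (M.memLp_effScore hM hk hkd hθ hη)
    (M.integral_effScore hM hk hkd hθ hη) (hE η hη).1 (hE η hη).2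
  refine (tendsto_measure_abs_ge hW ha).congr fun n => ?_
  exact (sampleLaw_apply _ (measurableSet_le measurable_const (E.measurable_W k n).abs)).symm

/-- If a coordinate of the efficient score is not centred, then the test statistic grows at least
linearly. -/
theorem exists_linear_lower_bound [IsProbabilityMeasure μ]
    (hpd : (M.effFisher k (M.null k) η).PosDef) (i : Fin k)
    (hint : Integrable (fun y => M.effScoreNull k η y i) μ)
    (hne : ∫ y, M.effScoreNull k η y i ∂μ ≠ 0)
    (hA : E.AverageConsistent M k η μ) (hL : E.InformationConsistent M k η μ) :
    ∃ δ > 0, Tendsto (fun n : ℕ => sampleLaw μ n {y | E.W k n y < δ * n}) atTop (𝓝 0) := by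
  obtain ⟨lam, hlam, ε, hε, hco⟩ := exists_coercive hpd.inv
  set C := ∫ y, M.effScoreNull k η y i ∂μ with hC
  have hCpos : 0 < |C| / 4 := by positivity
  -- Estimation and sampling errors below `|C| / 4` each leave `|x i| ≥ |C| / 2` for the averaged
  -- score `x`; `lam` is the coercivity constant.
  refine ⟨lam * (C ^ 2 / 4), by positivity, ?_⟩
  have hsw : ∀ n : ℕ, sampleLaw μ n {y | E.W k n y < lam * (C ^ 2 / 4) * n} =
      seqLaw μ (firstObs n ⁻¹' {y | E.W k n y < lam * (C ^ 2 / 4) * n}) := fun n =>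
    sampleLaw_apply μ (measurableSet_lt (E.measurable_W k n) measurable_const)
  simp_rw [hsw]
  refine tendsto_measure_zero_mono ?_ (tendsto_measure_zero_union (tendsto_measure_zero_union
    (tendsto_measure_zero_iUnion fun p : Fin k × Fin k =>
      tendsto_seqLaw_preimage μ (hL p.1 p.2 ε hε))
    (tendsto_seqLaw_preimage μ (hA _ hCpos))) (tendsto_average hint hCpos))
  filter_upwards [eventually_gt_atTop 0] with n hn ω hω
  by_contra hcon
  simp only [mem_union, mem_iUnion, mem_preimage, mem_ofPred_eq, not_or, not_exists, not_le,
    Prod.forall] at hcon hω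
  obtain ⟨⟨h1, h2⟩, h3⟩ := hcon
  have hn' : (0 : ℝ) < n := Nat.cast_pos.2 hn
  set y := firstObs n ω with hy
  set x : Fin k → ℝ := (n : ℝ)⁻¹ • ∑ j, E.l k n y j with hx
  have hW : E.W k n y = n * (x ⬝ᵥ E.L k n y *ᵥ x) := by
    have hns : E.normalizedSum k n y = √(n : ℝ) • x := by
      rw [normalizedSum, hx, smul_smul]
      congr 1
      rw [one_div, inv_eq_iff_eq_inv, _root_.mul_inv_rev, inv_inv, ← div_eq_mul_inv, Real.div_sqrt]
    rw [W, hns, mulVec_smul, smul_dotProduct, dotProduct_smul, smul_smul, Real.mul_self_sqrt hn'.le,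
      smul_eq_mul]
  have hxi : |x i - (n : ℝ)⁻¹ * ∑ j ∈ Finset.range n, M.effScoreNull k η (ω j) i| < |C| / 4 := by
    refine lt_of_le_of_lt ?_ h2
    have h4 := PiLp.norm_apply_le
      (WithLp.toLp 2 (∑ j, (E.l k n y j - M.effScoreNull k η (y j)))) i
    have h5 : x i - (n : ℝ)⁻¹ * ∑ j ∈ Finset.range n, M.effScoreNull k η (ω j) i =
        1 / (n : ℝ) * (∑ j, (E.l k n y j - M.effScoreNull k η (y j))) i := by
      rw [Finset.sum_range (fun j => M.effScoreNull k η (ω j) i)]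
      simp only [hx, Pi.smul_apply, Finset.sum_apply, Pi.sub_apply, Finset.sum_sub_distrib,
        smul_eq_mul, hy, firstObs, one_div, mul_sub]
    rw [h5, abs_mul, abs_of_pos (by positivity : (0 : ℝ) < 1 / n)]
    gcongr
    exact h4
  have hxC : |C| / 2 ≤ |x i| := by
    have h6 := abs_sub_abs_le_abs_sub C (x i)
    have h7 : |C - x i| ≤ |C| / 4 + |C| / 4 := by
      rw [abs_sub_comm]
      exact (abs_sub_le _ _ _).trans (add_le_add hxi.le h3.le)
    linarith
  have hsq : C ^ 2 / 4 ≤ x i ^ 2 := by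
    rw [← sq_abs C, ← sq_abs (x i)]
    nlinarith [abs_nonneg C]
  have hq := hco (E.L k n y) h1 x i
  rw [hW] at hω
  have : lam * (C ^ 2 / 4) ≤ x ⬝ᵥ E.L k n y *ᵥ x := (by gcongr : _ ≤ lam * x i ^ 2).trans hq
  nlinarith

end Estimators

/-- Subadditivity alone suffices, so it applies to the rejection events of `WS` without any
measurability of the selection rule. -/
lemma tendsto_measure_one_of_compl {Ω : ℕ → Type*} [∀ n, MeasurableSpace (Ω n)]
    {P : ∀ n, Measure (Ω n)} [∀ n, IsProbabilityMeasure (P n)] {s t : ∀ n, Set (Ω n)}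
    (h : ∀ᶠ n in atTop, (s n)ᶜ ⊆ t n) (ht : Tendsto (fun n => P n (t n)) atTop (𝓝 0)) :
    Tendsto (fun n => P n (s n)) atTop (𝓝 1) := by
  have hsub : Tendsto (fun n => 1 - P n (t n)) atTop (𝓝 1) := by
    simpa using ENNReal.Tendsto.sub tendsto_const_nhds ht (Or.inl ENNReal.one_ne_top)
  refine tendsto_of_tendsto_of_tendsto_of_le_of_le' hsub tendsto_const_nhds ?_
    (Eventually.of_forall fun n => prob_le_one)
  filter_upwards [h] with n hn
  rw [tsub_le_iff_right, ← measure_univ (μ := P n)]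
  refine (measure_mono fun x _ => ?_).trans (measure_union_le (s n) (t n))
  by_cases hx : x ∈ s n
  · exact Or.inl hx
  · exact Or.inr (hn hx)

lemma tendsto_measure_of_symmDiff_subset {Ω : ℕ → Type*} [∀ n, MeasurableSpace (Ω n)]
    {P : ∀ n, Measure (Ω n)} {s s' t : ∀ n, Set (Ω n)} {b : ENNReal}
    (hs : Tendsto (fun n => P n (s n)) atTop (𝓝 b))
    (ht : Tendsto (fun n => P n (t n)) atTop (𝓝 0))
    (h : ∀ᶠ n in atTop, s' n ⊆ s n ∪ t n) (h' : ∀ᶠ n in atTop, s n ⊆ s' n ∪ t n) :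
    Tendsto (fun n => P n (s' n)) atTop (𝓝 b) := by
  have hlow : Tendsto (fun n => P n (s n) - P n (t n)) atTop (𝓝 b) := by
    simpa using ENNReal.Tendsto.sub hs ht (Or.inr ENNReal.zero_ne_top)
  have hup : Tendsto (fun n => P n (s n) + P n (t n)) atTop (𝓝 b) := by
    simpa using hs.add ht
  refine tendsto_of_tendsto_of_tendsto_of_le_of_le' hlow hup ?_ ?_
  · filter_upwards [h'] with n hn
    rw [tsub_le_iff_right]
    exact (measure_mono hn).trans (measure_union_le _ _)
  · filter_upwards [h] with n hn
    exact (measure_mono hn).trans (measure_union_le _ _)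

instance (μ : Measure ℝ) [IsProbabilityMeasure μ] (n : ℕ) : IsProbabilityMeasure (sampleLaw μ n) :=
  by unfold sampleLaw; infer_instance

/-! ### The selection rule and the three claims -/

namespace Estimators

variable {E : Estimators} {d m : ℕ} {M : Model d m} {k : ℕ} {η : Fin m → ℝ} {μ : Measure ℝ}

/-- A maximizer over the nonempty range `1, …, d` exists, so the `sInf` is attained and is not the
default value 0. -/
lemma S_mem (E : Estimators) (hd : 1 ≤ d) (π : ℕ → ℕ → ℝ) (n : ℕ) (y : Fin n → ℝ) :
    1 ≤ E.S d π n y ∧ E.S d π n y ≤ d ∧ ∀ j, 1 ≤ j → j ≤ d →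
      E.W j n y - π j n ≤ E.W (E.S d π n y) n y - π (E.S d π n y) n := by
  refine Nat.sInf_mem (s := {k | 1 ≤ k ∧ k ≤ d ∧ ∀ j, 1 ≤ j → j ≤ d →
    E.W j n y - π j n ≤ E.W k n y - π k n}) ?_
  obtain ⟨k, hk, hmax⟩ := Finset.exists_max_image (Finset.Icc 1 d)
    (fun j => E.W j n y - π j n) ⟨1, by simp [hd]⟩
  rw [Finset.mem_Icc] at hk
  exact ⟨k, hk.1, hk.2, fun j h1 h2 => hmax j (Finset.mem_Icc.2 ⟨h1, h2⟩)⟩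

lemma S_eq_one (E : Estimators) (hd : 1 ≤ d) {π : ℕ → ℕ → ℝ} {n : ℕ} {y : Fin n → ℝ}
    (h : ∀ j, 2 ≤ j → j ≤ d → E.W j n y - π j n ≤ E.W 1 n y - π 1 n) : E.S d π n y = 1 := by
  refine le_antisymm (Nat.sInf_le ⟨le_rfl, hd, fun j h1 h2 => ?_⟩) (E.S_mem hd π n y).1
  rcases h1.eq_or_lt with rfl | h1
  · exact le_rfl
  · exact h j h1 h2

/-- The test statistic of every dimension that is large enough detects the alternative. -/
theorem exists_linear_lower_bound_of_C1 [IsProbabilityMeasure μ] (hM : M.Regular) (hη : η ∈ M.Λ)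
    {K : ℕ} (hC1 : M.C1 μ η K) (hkd : k ≤ d) (hKk : K ≤ k) (hA : E.AverageConsistent M k η μ)
    (hL : E.InformationConsistent M k η μ) :
    ∃ δ > 0, Tendsto (fun n : ℕ => sampleLaw μ n {y | E.W k n y < δ * n}) atTop (𝓝 0) := by
  obtain ⟨hK1, hKd, -, hCK⟩ := hC1
  have hk : 1 ≤ k := hK1.trans hKk
  -- Coordinates are indexed from 0: the `K`-th one has index `K - 1`.
  have hi : K - 1 < k := by omega
  have heq := fun y => M.effScoreNull_eq hk hkd le_rfl η y ⟨K - 1, hi⟩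
  obtain ⟨hint, hne⟩ := hCK ⟨K - 1, by omega⟩ (by simp; omega)
  refine exists_linear_lower_bound (M.posDef_effFisher hM hk hkd (M.null_mem' hk hkd) hη)
    ⟨K - 1, hi⟩ ?_ ?_ hA hL
  · simp only [heq]
    exact hint
  · simp only [heq]
    exact hne

theorem consistentAgainst_W [IsProbabilityMeasure μ] (hM : M.Regular) (hη : η ∈ M.Λ) {K : ℕ}
    (hC1 : M.C1 μ η K) (hkd : k ≤ d) (hKk : K ≤ k) (hE : E.GoodUnderNull M k)
    (hA : E.AverageConsistent M k η μ) (hL : E.InformationConsistent M k η μ) :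
    ConsistentAgainst (E.W k) (chiSq k) (M.nullLaws k) μ := by
  intro α _ c hc
  constructor
  · rintro μ₀ ⟨η', hη', rfl⟩
    rw [← hc]
    exact tendsto_power_W_null hM (hC1.1.trans hKk) hkd hη' hE c
  · obtain ⟨δ, hδ, hlim⟩ := exists_linear_lower_bound_of_C1 hM hη hC1 hkd hKk hA hL
    refine tendsto_measure_one_of_compl ?_ hlim
    filter_upwards [(tendsto_natCast_atTop_atTop.const_mul_atTop hδ).eventually_gt_atTop c]
      with n hn y hy
    exact (not_lt.1 (show ¬ c < E.W k n y from hy)).trans_lt hn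

theorem inconsistentAgainst_W [IsProbabilityMeasure μ] {K : ℕ} (hC1 : M.C1 μ η K) (hk : 1 ≤ k)
    (hkK : k < K) (hv : ∀ i, MemLp (fun y => M.effScoreNull k η y i) 2 μ)
    (hS : E.SufficientlyGood M k η μ) (hL : E.InformationConsistent M k η μ) :
    InconsistentAgainst (E.W k) (chiSq k) μ := by
  intro α hα c hc
  have hcpos := pos_of_isCritical_chiSq hk hα.2 hc
  obtain ⟨-, hKd, hzero, -⟩ := hC1
  have hkd : k ≤ d := by omega
  have h0 : ∀ i, ∫ y, M.effScoreNull k η y i ∂μ = 0 := by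
    intro i
    simp only [M.effScoreNull_eq hk hkd le_rfl]
    exact (hzero (Fin.castLE hkd i) (by simp; omega)).2
  have hle := limsup_measure_closed_le (tendstoInDistribution_W hv h0 hS hL) (isClosed_Ici (a := c))
  have hlt : multivariateGaussian 0 (secondMoment μ (M.effScoreNull k η))
      (quadForm (M.effFisher k (M.null k) η)⁻¹ ⁻¹' Ici c) < 1 := by
    rw [← compl_Iio, preimage_compl, prob_compl_eq_one_sub
      ((continuous_quadForm _).measurable measurableSet_Iio)]
    exact ENNReal.sub_lt_self ENNReal.one_ne_top one_ne_zero
      (multivariateGaussian_quadForm_lt_pos _ _ hcpos).ne'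
  -- The limsup bound holds eventually only with some slack, so `β` is taken strictly between the
  -- limsup and 1.
  obtain ⟨β, hβ1, hβ2⟩ := exists_between (hle.trans_lt hlt)
  refine ⟨β, hβ2, ?_⟩
  filter_upwards [eventually_lt_of_limsup_lt hβ1] with n hn
  rw [power, sampleLaw_apply _ (measurableSet_lt measurable_const (E.measurable_W k n))]
  exact (measure_mono fun ω hω => le_of_lt (show c < E.W k n (firstObs n ω) from hω)).trans hn.le

theorem consistentAgainst_WS [IsProbabilityMeasure μ] (hM : M.Regular) (hη : η ∈ M.Λ) {K : ℕ}
    (hC1 : M.C1 μ η K) {π : ℕ → ℕ → ℝ} (hπ : IsPenalty d π) (hS1 : S1 d π)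
    (hE : ∀ k, 1 ≤ k → k ≤ d → E.GoodUnderNull M k)
    (hA : E.AverageConsistent M K η μ) (hL : E.InformationConsistent M K η μ) :
    ConsistentAgainst (E.WS d π) (chiSq 1) (M.nullLaws d) μ := by
  have hK1 := hC1.1
  have hKd := hC1.2.1
  have hd : 1 ≤ d := hK1.trans hKd
  intro α _ c hc
  constructor
  · rintro μ₀ ⟨η', hη', rfl⟩
    have hG : ∀ j, 1 ≤ j → j ≤ d → M.G j (M.null j) η' = M.G d (M.null d) η' := fun j h1 h2 => by
      rw [M.G_null_eq h1 h2 le_rfl]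
    have hW1 := tendsto_power_W_null hM le_rfl hd hη' (hE 1 le_rfl hd) c
    rw [hG 1 le_rfl hd, hc] at hW1
    have ht : Tendsto (fun n => sampleLaw (M.G d (M.null d) η') n
        (⋃ j : Finset.Icc 2 d, ({y | (π j n - π 1 n) / 2 ≤ |E.W j n y|} ∪
          {y | (π j n - π 1 n) / 2 ≤ |E.W 1 n y|}))) atTop (𝓝 0) := by
      refine tendsto_measure_zero_iUnion fun ⟨j, hj⟩ => ?_
      rw [Finset.mem_Icc] at hj
      -- If `|W_j|` and `|W_1|` both stay below half the penalty gap, dimension `j` cannot beat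
      -- dimension 1.
      have ha : Tendsto (fun n => (π j n - π 1 n) / 2) atTop atTop :=
        (hπ.2 j hj.1 hj.2).atTop_div_const two_pos
      have hj1 : 1 ≤ j := by omega
      have h1 := tendsto_measure_abs_W_ge_null hM hj1 hj.2 hη' (hE j hj1 hj.2) ha
      have h2 := tendsto_measure_abs_W_ge_null hM le_rfl hd hη' (hE 1 le_rfl hd) ha
      rw [hG j hj1 hj.2] at h1
      rw [hG 1 le_rfl hd] at h2
      exact tendsto_measure_zero_union h1 h2
    have hWS : ∀ n (y : Fin n → ℝ), y ∉ (⋃ j : Finset.Icc 2 d,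
        ({y : Fin n → ℝ | (π j n - π 1 n) / 2 ≤ |E.W j n y|} ∪
          {y | (π j n - π 1 n) / 2 ≤ |E.W 1 n y|})) → E.WS d π n y = E.W 1 n y := by
      intro n y hy
      simp only [mem_iUnion, mem_union, mem_ofPred_eq, not_exists, not_or, not_le, Subtype.forall,
        Finset.mem_Icc] at hy
      rw [WS, E.S_eq_one hd fun j h2 hjd => ?_]
      obtain ⟨h3, h4⟩ := hy j ⟨h2, hjd⟩
      have h5 := le_abs_self (E.W j n y)
      have h6 := neg_abs_le (E.W 1 n y)
      linarith
    refine tendsto_measure_of_symmDiff_subset hW1 ht (Eventually.of_forall fun n y hy => ?_)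
      (Eventually.of_forall fun n y hy => ?_)
    · by_contra hcon
      rw [mem_union, not_or] at hcon
      refine hcon.1 ?_
      rw [mem_ofPred_eq, ← hWS n y hcon.2]
      exact hy
    · by_contra hcon
      rw [mem_union, not_or] at hcon
      refine hcon.1 ?_
      rw [mem_ofPred_eq, hWS n y hcon.2]
      exact hy
  · obtain ⟨δ, hδ, hlim⟩ := exists_linear_lower_bound_of_C1 hM hη hC1 hKd le_rfl hA hL
    refine tendsto_measure_one_of_compl ?_ hlim
    -- The penalties of `K` and of the random `S` cost at most `δ n / 2` together; the remaining `δ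
    -- n / 2` exceeds `c`. Uniformity in `j` is needed because `S` depends on the data.
    have hsmall : ∀ᶠ n : ℕ in atTop, ∀ j ∈ Finset.Icc 1 d, ‖π j n‖ ≤ δ / 4 * ‖(n : ℝ)‖ := by
      rw [eventually_all_finset]
      intro j hj
      rw [Finset.mem_Icc] at hj
      exact (hS1 j hj.1 hj.2).bound (by positivity)
    filter_upwards [hsmall, (tendsto_natCast_atTop_atTop.const_mul_atTop
      (half_pos hδ)).eventually_gt_atTop c] with n hn hcn y hy
    obtain ⟨hs1, hs2, hmax⟩ := E.S_mem hd π n y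
    have h1 := hmax K hK1 hKd
    have h2 := hn K (Finset.mem_Icc.2 ⟨hK1, hKd⟩)
    have h3 := hn _ (Finset.mem_Icc.2 ⟨hs1, hs2⟩)
    simp only [Real.norm_eq_abs, Nat.abs_cast] at h2 h3
    have h4 : E.W (E.S d π n y) n y ≤ c := not_lt.1 (show ¬ c < E.WS d π n y from hy)
    have h5 := (abs_le.1 h2).2
    have h6 := (abs_le.1 h3).1
    change E.W K n y < δ * n
    linarith

end Estimators

end Deconv

end

theorem mainTheorem2 {d m : ℕ} (M : Deconv.Model d m) (hM : M.Regular) (E : Deconv.Estimators)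
    (F H : Measure ℝ) [IsProbabilityMeasure F] [IsProbabilityMeasure H]
    (η₀ : Fin m → ℝ) (hη₀ : η₀ ∈ M.Λ) (K : ℕ) (hC1 : M.C1 (Measure.conv F H) η₀ K) :
    (∀ k, 1 ≤ k → k ≤ d → K ≤ k →
      E.GoodUnderNull M k →
      E.AverageConsistent M k η₀ (Measure.conv F H) →
      E.InformationConsistent M k η₀ (Measure.conv F H) →
      Deconv.ConsistentAgainst (E.W k) (Deconv.chiSq k) (M.nullLaws k) (Measure.conv F H)) ∧
    (∀ k, 1 ≤ k → k < K →
      (∀ i, MemLp (fun y => M.effScoreNull k η₀ y i) 2 (Measure.conv F H)) →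
      E.SufficientlyGood M k η₀ (Measure.conv F H) →
      E.InformationConsistent M k η₀ (Measure.conv F H) →
      Deconv.InconsistentAgainst (E.W k) (Deconv.chiSq k) (Measure.conv F H)) ∧
    (∀ π : ℕ → ℕ → ℝ, Deconv.IsPenalty d π → Deconv.S1 d π →
      (∀ k, 1 ≤ k → k ≤ d →
        E.GoodUnderNull M k ∧
        E.AverageConsistent M k η₀ (Measure.conv F H) ∧
        E.InformationConsistent M k η₀ (Measure.conv F H)) →
      Deconv.ConsistentAgainst (E.WS d π) (Deconv.chiSq 1) (M.nullLaws d)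
        (Measure.conv F H)) := by
  refine ⟨fun k _ hkd hKk hE hA hL => ?_, fun k hk hkK hv hS hL => ?_, fun π hπ hS1 h => ?_⟩
  · exact Deconv.Estimators.consistentAgainst_W hM hη₀ hC1 hkd hKk hE hA hL
  · exact Deconv.Estimators.inconsistentAgainst_W hC1 hk hkK hv hS hL
  · have hK := h K hC1.1 hC1.2.1
    exact Deconv.Estimators.consistentAgainst_WS hM hη₀ hC1 hπ hS1 (fun k hk hkd => (h k hk hkd).1)
      hK.2.1 hK.2.2
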